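/- Let $\mathfrak n=\mathfrak v\oplus\mathfrak z$, $\mathfrak n\neq\{0\}$, be an $H$-type Lie algebra: $\mathfrak v,\mathfrak z$ are orthogonal in a finite-dimensional real inner product space, $[\mathfrak n,\mathfrak z]=0$, $[\mathfrak n,\mathfrak n]\subseteq\mathfrak z$, and the maps $J_Z:\mathfrak v\to\mathfrak v$ defined by $\langle J_ZX,Y\rangle=\langle Z,[X,Y]\rangle$ satisfy $|J_ZX|=|Z||X|$ (abelian $\mathfrak n$ allowed). Let $N=\mathfrak v\times\mathfrak z$ be the corresponding group, with product $(X,Z)(X',Z')=(X+X',Z+Z'+\frac12[X,X'])$ and Haar measure $dX\,dZ$, let $\mathcal N(X,Z)=(|X|^4/16+|Z|^2)^{1/4}$, and let $B_N(n,r)=\{m\in N:\mathcal N(n^{-1}m)<r\}$. Let $S=\mathfrak v\times\mathfrak z\times\mathbb R^+=N\times\mathbb R^+$ be the associated Damek–Ricci space, with product $$(X,Z,a)(X',Z',a')=\bigl(X+a^{1/2}X',\,Z+aZ'+\tfrac12a^{1/2}[X,X'],\,aa'\bigr),$$ right Haar measure $d\rho(X,Z,a)=a^{-1}\,dX\,dZ\,da$,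 and the left-invariant Riemannian metric which at the identity $(0,0,1)$ is the orthogonal sum of the inner products of $\mathfrak v$, $\mathfrak z$ and $\mathbb R$. For a family $\mathcal F$ of open subsets of $S$ and $f\in L^1(\rho)$ put $$M^{\mathcal F}f(x)=\sup_{F\in\mathcal F,\;x\in F}\frac1{\rho(F)}\int_F|f|\,d\rho .$$ Consider the following families. 1. $\mathcal R^0$: the geodesic balls of $S$ of radius $r<1/2$. 2. $\mathcal R^\infty$: the left translates $x_0E_{r,b}$, where $x_0\in S$, $r\ge e$, $b'<b<b''$ and $E_{r,b}=B_N(0_N,r^b)\times(1/r,r)$. Here $1/2<b'<b''$ are fixed constants. 3. $\mathcal D^\infty$: the sets $Q^k_\alpha\times(a_0/r,a_0r)$, where $k\in\mathbb Z$, $\alpha\in I_k$, $a_0>0$, $r\ge e$ and $a_0^{1/2}r^\beta\le\delta^k<a_0^{1/2}r^{4\beta}$. Here $\beta>3/2$ is a fixed constant and $\{Q^k_\alpha:k\in\mathbb Z,\ \alpha\in I_k\}$ (with $I_k$ countable) is a fixed system of dyadic sets of $N$ in the sense of Christ: for some constants $\delta>1$, $c_N,C_N>0$ and an integer $M$, the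 $Q^k_\alpha$ are open subsets of $N$; for each $k$ they are pairwise disjoint and cover $N$ up to a null set; there are points $n^k_\alpha\in N$ with $B_N(n^k_\alpha,c_N\delta^k)\subseteq Q^k_\alpha\subseteq B_N(n^k_\alpha,C_N\delta^k)$; each $Q^k_\alpha$ contains at most $M$ sets $Q^{k-1}_\beta$; and if $\ell\le k$, then each $Q^\ell_\beta$ is contained in exactly one $Q^k_\alpha$, and is either contained in or disjoint from any given $Q^k_\alpha$. Then $M^{\mathcal R^0}$, $M^{\mathcal R^\infty}$ and $M^{\mathcal D^\infty}$ are bounded from $L^1(\rho)$ to $L^{1,\infty}(\rho)$: for each of the three families $\mathcal F$ there is a constant $C$ such that, for all $f\in L^1(\rho)$, the function $M^{\mathcal F}f$ is measurable and $$t\,\rho\bigl(\{x\in S: M^{\mathcal F}f(x)>t\}\bigr)\le C\,\|f\|_{L^1(\rho)}\qquad\text{for all }t>0 .$$ -/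

import Mathlib

open MeasureTheory Set
open scoped ENNReal NNReal Manifold Bundle ContDiff

noncomputable section

/-- A Lie algebra `𝔫 = 𝔳 ⊕ 𝔷` of Heisenberg type. `V` and `Z` are the orthogonal summands `𝔳` and
`𝔷`; the Lie bracket of `𝔫` vanishes on `𝔷` and takes its values in `𝔷`, so that it is given by an
alternating bilinear map `V × V → Z`. The map `J_z : V → V` with `⟪J_z x, y⟫ = ⟪z, [x, y]⟫` is
`z ↦ (ad x)* z`, and the `H`-type condition is `|J_z x| = |z| |x|`. The abelian algebras
(`Z` or `V` trivial) are included. -/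
structure HTypeAlgebra (V Z : Type*) [NormedAddCommGroup V] [InnerProductSpace ℝ V]
    [FiniteDimensional ℝ V] [NormedAddCommGroup Z] [InnerProductSpace ℝ Z]
    [FiniteDimensional ℝ Z] where
  bracket : V →ₗ[ℝ] V →ₗ[ℝ] Z
  bracket_self : ∀ x : V, bracket x x = 0
  norm_J : ∀ (z : Z) (x : V), ‖LinearMap.adjoint (bracket x) z‖ = ‖z‖ * ‖x‖

namespace HTypeAlgebra

variable {V Z : Type*} [NormedAddCommGroup V] [InnerProductSpace ℝ V] [FiniteDimensional ℝ V]
  [NormedAddCommGroup Z] [InnerProductSpace ℝ Z] [FiniteDimensional ℝ Z]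

/-! ### The `H`-type group -/

/-- The `H`-type group `N`, identified with `𝔳 × 𝔷` through the exponential map. -/
def N (_h : HTypeAlgebra V Z) : Type _ := V × Z

instance (h : HTypeAlgebra V Z) : TopologicalSpace h.N := inferInstanceAs (TopologicalSpace (V × Z))

/-- Lebesgue measure `dX dZ`, a Haar measure of `N`. -/
instance [MeasurableSpace V] [BorelSpace V] [MeasurableSpace Z] [BorelSpace Z]
    (h : HTypeAlgebra V Z) : MeasureSpace h.N := inferInstanceAs (MeasureSpace (V × Z))

/-- `(X, Z) (X', Z') = (X + X', Z + Z' + [X, X'] / 2)`. -/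
instance instGroupN (h : HTypeAlgebra V Z) : Group h.N where
  mul n m := (n.1 + m.1, n.2 + m.2 + (1 / 2 : ℝ) • h.bracket n.1 m.1)
  one := (0, 0)
  inv n := (-n.1, -n.2)
  mul_assoc n m p := by
    refine Prod.ext (add_assoc n.1 m.1 p.1) ?_
    change n.2 + m.2 + (1 / 2 : ℝ) • h.bracket n.1 m.1 + p.2
        + (1 / 2 : ℝ) • h.bracket (n.1 + m.1) p.1
      = n.2 + (m.2 + p.2 + (1 / 2 : ℝ) • h.bracket m.1 p.1)
        + (1 / 2 : ℝ) • h.bracket n.1 (m.1 + p.1)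
    simp only [map_add, LinearMap.add_apply, smul_add]
    abel
  one_mul n := by
    refine Prod.ext (zero_add n.1) ?_
    change 0 + n.2 + (1 / 2 : ℝ) • h.bracket 0 n.1 = n.2
    simp
  mul_one n := by
    refine Prod.ext (add_zero n.1) ?_
    change n.2 + 0 + (1 / 2 : ℝ) • h.bracket n.1 0 = n.2
    simp
  inv_mul_cancel n := by
    refine Prod.ext (neg_add_cancel n.1) ?_
    change -n.2 + n.2 + (1 / 2 : ℝ) • h.bracket (-n.1) n.1 = 0
    simpa using h.bracket_self n.1

/-- The homogeneous norm `(|X|⁴ / 16 + |Z|²) ^ (1/4)` on `N`. -/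
def homNorm (h : HTypeAlgebra V Z) (n : h.N) : ℝ :=
  (‖n.1‖ ^ 4 / 16 + ‖n.2‖ ^ 2) ^ (1 / 4 : ℝ)

/-- The homogeneous ball `B_N(n, r)`, for the distance `d_N(n, m) = 𝒩(n⁻¹ m)`. -/
def ballN (h : HTypeAlgebra V Z) (n : h.N) (r : ℝ) : Set h.N :=
  {m | h.homNorm (n⁻¹ * m) < r}

/-! ### The Damek–Ricci space -/

/-- The coordinate domain `𝔳 × 𝔷 × ℝ⁺`. -/
def coordDomain (_h : HTypeAlgebra V Z) : TopologicalSpace.Opens (V × Z × ℝ) :=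
  ⟨{p | 0 < p.2.2}, isOpen_lt continuous_const (continuous_snd.comp continuous_snd)⟩

/-- The Damek–Ricci space `S` attached to `𝔫`, in the global coordinates
`(X, Z, a) ↦ exp (X + Z) exp (log a H)`, with `X ∈ 𝔳`, `Z ∈ 𝔷`, `a > 0`. -/
def S (h : HTypeAlgebra V Z) : Type _ := h.coordDomain

instance (h : HTypeAlgebra V Z) : TopologicalSpace h.S :=
  inferInstanceAs (TopologicalSpace h.coordDomain)

instance [MeasurableSpace V] [MeasurableSpace Z] (h : HTypeAlgebra V Z) : MeasurableSpace h.S :=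
  inferInstanceAs (MeasurableSpace {p : V × Z × ℝ // p ∈ h.coordDomain})

instance [MeasurableSpace V] [BorelSpace V] [MeasurableSpace Z] [BorelSpace Z]
    (h : HTypeAlgebra V Z) : BorelSpace h.S :=
  inferInstanceAs (BorelSpace {p : V × Z × ℝ // p ∈ h.coordDomain})

/-- The manifold structure of `S` as an open subset of the vector space `𝔳 × 𝔷 × ℝ`. -/
instance (h : HTypeAlgebra V Z) : ChartedSpace (V × Z × ℝ) h.S :=
  inferInstanceAs (ChartedSpace (V × Z × ℝ) h.coordDomain)

instance (h : HTypeAlgebra V Z) : IsManifold 𝓘(ℝ, V × Z × ℝ) ∞ h.S :=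
  inferInstanceAs (IsManifold 𝓘(ℝ, V × Z × ℝ) ∞ h.coordDomain)

namespace S

variable {h : HTypeAlgebra V Z}

/-- The point with coordinates `(x, z, a)`. -/
def mk (x : V) (z : Z) (a : ℝ) (ha : 0 < a) : h.S := ⟨(x, z, a), ha⟩

/-- The coordinates `(X, Z, a)` of a point. -/
def coords (p : h.S) : V × Z × ℝ := p.1

/-- The coordinate `X`. -/
def x (p : h.S) : V := p.1.1

/-- The coordinate `Z`. -/
def z (p : h.S) : Z := p.1.2.1

/-- The coordinate `a`. -/
def a (p : h.S) : ℝ := p.1.2.2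

/-- The component `(X, Z)` of a point in `N`. -/
def n (p : h.S) : h.N := (p.x, p.z)

theorem a_pos (p : h.S) : 0 < p.a := p.2

theorem ext {p q : h.S} (hx : p.x = q.x) (hz : p.z = q.z) (ha : p.a = q.a) : p = q :=
  Subtype.ext (Prod.ext hx (Prod.ext hz ha))

/-- `(X, Z, a) (X', Z', a') = (X + a^{1/2} X', Z + a Z' + a^{1/2} [X, X'] / 2, a a')`. -/
instance instGroup : Group h.S where
  mul p q := mk (p.x + √p.a • q.x) (p.z + p.a • q.z + (1 / 2 * √p.a) • h.bracket p.x q.x)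
    (p.a * q.a) (mul_pos p.a_pos q.a_pos)
  one := mk 0 0 1 one_pos
  inv p := mk (-((√p.a)⁻¹ • p.x)) (-(p.a⁻¹ • p.z)) p.a⁻¹ (inv_pos.2 p.a_pos)
  mul_assoc p q r := by
    have hs : √(p.a * q.a) = √p.a * √q.a := Real.sqrt_mul p.a_pos.le _
    have hp : √p.a * √p.a = p.a := Real.mul_self_sqrt p.a_pos.le
    refine ext ?_ ?_ (mul_assoc p.a q.a r.a)
    · change p.x + √p.a • q.x + √(p.a * q.a) • r.x = p.x + √p.a • (q.x + √q.a • r.x)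
      rw [hs, smul_add, smul_smul, add_assoc]
    · change p.z + p.a • q.z + (1 / 2 * √p.a) • h.bracket p.x q.x + (p.a * q.a) • r.z
          + (1 / 2 * √(p.a * q.a)) • h.bracket (p.x + √p.a • q.x) r.x
        = p.z + p.a • (q.z + q.a • r.z + (1 / 2 * √q.a) • h.bracket q.x r.x)
          + (1 / 2 * √p.a) • h.bracket p.x (q.x + √q.a • r.x)
      rw [hs]
      simp only [map_add, map_smul, LinearMap.add_apply, LinearMap.smul_apply, smul_add, smul_smul]
      rw [show 1 / 2 * (√p.a * √q.a) * √p.a = p.a * (1 / 2 * √q.a) by linear_combination (1 / 2 * √q.a) * hp,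
        show 1 / 2 * √p.a * √q.a = 1 / 2 * (√p.a * √q.a) by ring]
      abel
  one_mul p := by
    refine ext ?_ ?_ (one_mul p.a)
    · change 0 + √1 • p.x = p.x
      simp
    · change 0 + (1 : ℝ) • p.z + (1 / 2 * √1) • h.bracket 0 p.x = p.z
      simp
  mul_one p := by
    refine ext ?_ ?_ (mul_one p.a)
    · change p.x + √p.a • 0 = p.x
      simp
    · change p.z + p.a • 0 + (1 / 2 * √p.a) • h.bracket p.x 0 = p.z
      simp
  inv_mul_cancel p := by
    refine ext ?_ ?_ (inv_mul_cancel₀ p.a_pos.ne')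
    · change -((√p.a)⁻¹ • p.x) + √(p.a⁻¹) • p.x = 0
      rw [Real.sqrt_inv, neg_add_cancel]
    · change -(p.a⁻¹ • p.z) + p.a⁻¹ • p.z
          + (1 / 2 * √(p.a⁻¹)) • h.bracket (-((√p.a)⁻¹ • p.x)) p.x = 0
      simp [h.bracket_self]

/-- The right Haar measure `dρ(X, Z, a) = a⁻¹ dX dZ da` of `S`. -/
def ρ [MeasurableSpace V] [BorelSpace V] [MeasurableSpace Z] [BorelSpace Z] : Measure h.S :=
  ((volume : Measure (V × Z × ℝ)).comap coords).withDensity (fun p ↦ ENNReal.ofReal p.a⁻¹)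

/-! ### The left-invariant Riemannian metric -/

/-- The differential at the identity of the left translation by `p`, as an automorphism of the vector
space `𝔳 × 𝔷 × ℝ`: in coordinates, it is `(u, w, t) ↦ (a^{1/2} u, a w + a^{1/2} [X, u] / 2, a t)`. -/
def frame (p : h.S) : (V × Z × ℝ) ≃L[ℝ] (V × Z × ℝ) :=
  LinearEquiv.toContinuousLinearEquiv
    { toFun := fun v ↦ (√p.a • v.1, p.a • v.2.1 + (1 / 2 * √p.a) • h.bracket p.x v.1, p.a * v.2.2)
      map_add' := fun v w ↦ by
        refine Prod.ext (smul_add _ _ _) (Prod.ext ?_ (mul_add _ _ _))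
        simp only [Prod.fst_add, Prod.snd_add, map_add, smul_add]
        abel
      map_smul' := fun c v ↦ by
        refine Prod.ext (smul_comm _ _ _) (Prod.ext ?_ (mul_left_comm _ _ _))
        simp only [Prod.smul_fst, Prod.smul_snd, map_smul, RingHom.id_apply, smul_add]
        rw [smul_comm p.a c, smul_comm _ c]
      invFun := fun v ↦ ((√p.a)⁻¹ • v.1, p.a⁻¹ • (v.2.1 - (1 / 2 : ℝ) • h.bracket p.x v.1),
        p.a⁻¹ * v.2.2)
      left_inv := fun v ↦ by
        have hs : √p.a ≠ 0 := (Real.sqrt_pos.2 p.a_pos).ne'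
        refine Prod.ext (inv_smul_smul₀ hs _) (Prod.ext ?_ (inv_mul_cancel_left₀ p.a_pos.ne' _))
        simp only [map_smul, smul_smul, add_sub_cancel_right]
        rw [inv_mul_cancel₀ p.a_pos.ne', one_smul]
      right_inv := fun v ↦ by
        have hs : √p.a ≠ 0 := (Real.sqrt_pos.2 p.a_pos).ne'
        refine Prod.ext (smul_inv_smul₀ hs _) (Prod.ext ?_ (mul_inv_cancel_left₀ p.a_pos.ne' _))
        simp only [map_smul, smul_smul]
        rw [mul_inv_cancel₀ p.a_pos.ne', one_smul, mul_assoc, mul_inv_cancel₀ hs, mul_one,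
          sub_add_cancel] }

/-- In coordinates, the left translation by `p` is an affine map with linear part `p.frame`. -/
theorem coords_mul (p q : h.S) : (p * q).coords = (p.x, p.z, 0) + p.frame q.coords := by
  refine Prod.ext rfl (Prod.ext ?_ (zero_add _).symm)
  exact add_assoc _ _ _

/-- The inner product of `𝔰 = 𝔳 ⊕ 𝔷 ⊕ ℝ H` (orthogonal sum, `|H| = 1`). -/
def innerAtIdentity : (V × Z × ℝ) →L[ℝ] (V × Z × ℝ) →L[ℝ] ℝ :=
  (innerSL ℝ).bilinearComp (.fst ℝ V (Z × ℝ)) (.fst ℝ V (Z × ℝ))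
    + (innerSL ℝ).bilinearComp (.fst ℝ Z ℝ ∘L .snd ℝ V (Z × ℝ)) (.fst ℝ Z ℝ ∘L .snd ℝ V (Z × ℝ))
    + (innerSL ℝ).bilinearComp (.snd ℝ Z ℝ ∘L .snd ℝ V (Z × ℝ))
        (.snd ℝ Z ℝ ∘L .snd ℝ V (Z × ℝ))

theorem innerAtIdentity_apply (v w : V × Z × ℝ) :
    innerAtIdentity v w = inner ℝ v.1 w.1 + inner ℝ v.2.1 w.2.1 + inner ℝ v.2.2 w.2.2 := rfl

theorem innerAtIdentity_self (v : V × Z × ℝ) :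
    innerAtIdentity v v = ‖v.1‖ ^ 2 + ‖v.2.1‖ ^ 2 + ‖v.2.2‖ ^ 2 := by
  simp only [innerAtIdentity_apply, real_inner_self_eq_norm_sq]

/-- The left-invariant inner product on the tangent space at `p`. -/
def metricForm (p : h.S) : (V × Z × ℝ) →L[ℝ] (V × Z × ℝ) →L[ℝ] ℝ :=
  innerAtIdentity.bilinearComp (p.frame.symm : (V × Z × ℝ) →L[ℝ] (V × Z × ℝ))
    (p.frame.symm : (V × Z × ℝ) →L[ℝ] (V × Z × ℝ))

theorem metricForm_apply (p : h.S) (v w : V × Z × ℝ) :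
    p.metricForm v w = innerAtIdentity (p.frame.symm v) (p.frame.symm w) := rfl

theorem metricForm_symm (p : h.S) (v w : V × Z × ℝ) : p.metricForm v w = p.metricForm w v := by
  simp only [metricForm_apply, innerAtIdentity_apply, real_inner_comm]

theorem metricForm_pos (p : h.S) (v : V × Z × ℝ) (hv : v ≠ 0) : 0 < p.metricForm v v := by
  rw [metricForm_apply, innerAtIdentity_self]
  by_contra hle
  have h0 : p.frame.symm v = 0 := by
    refine Prod.ext (norm_eq_zero.1 ?_) (Prod.ext (norm_eq_zero.1 ?_) (norm_eq_zero.1 ?_)) <;>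
    · refine pow_eq_zero_iff two_ne_zero |>.1 (le_antisymm ?_ (sq_nonneg _))
      linarith [sq_nonneg ‖(p.frame.symm v).1‖, sq_nonneg ‖(p.frame.symm v).2.1‖,
        sq_nonneg ‖(p.frame.symm v).2.2‖]
  exact hv ((map_eq_zero_iff _ p.frame.symm.injective).1 h0)

theorem metricForm_continuousAt (p : h.S) :
    ContinuousAt (fun v : V × Z × ℝ ↦ p.metricForm v v) 0 := by
  fun_prop

theorem metricForm_isVonNBounded (p : h.S) :
    Bornology.IsVonNBounded ℝ {v : V × Z × ℝ | p.metricForm v v < 1} := by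
  refine ((NormedSpace.isVonNBounded_ball ℝ (V × Z × ℝ) 1).image
    (p.frame : (V × Z × ℝ) →L[ℝ] (V × Z × ℝ))).subset ?_
  intro v hv
  refine ⟨p.frame.symm v, ?_, p.frame.apply_symm_apply v⟩
  have h1 : p.metricForm v v < 1 := hv
  rw [metricForm_apply, innerAtIdentity_self] at h1
  have h2 := sq_nonneg ‖(p.frame.symm v).1‖
  have h3 := sq_nonneg ‖(p.frame.symm v).2.1‖
  have h4 := sq_nonneg ‖(p.frame.symm v).2.2‖
  rw [mem_ball_zero_iff, Prod.norm_def, Prod.norm_def]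
  refine max_lt ?_ (max_lt ?_ ?_) <;> exact (sq_lt_one_iff₀ (norm_nonneg _)).1 (by linarith)

/-- The left-invariant Riemannian metric of `S`. -/
instance instRiemannianBundle :
    Bundle.RiemannianBundle (fun p : h.S ↦ TangentSpace 𝓘(ℝ, V × Z × ℝ) p) where
  g :=
    { inner := fun p ↦ p.metricForm
      symm := fun p ↦ p.metricForm_symm
      pos := fun p ↦ p.metricForm_pos
      continuousAt := fun p ↦ p.metricForm_continuousAt
      isVonNBounded := fun p ↦ p.metricForm_isVonNBounded }

/-- The open ball of centre `p` and radius `r` for the Riemannian distance of `S`. -/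
def geodesicBall (p : h.S) (r : ℝ) : Set h.S :=
  {q | Manifold.riemannianEDist 𝓘(ℝ, V × Z × ℝ) p q < ENNReal.ofReal r}

end S

/-! ### Maximal operators -/

section Maximal

variable [MeasurableSpace V] [BorelSpace V] [MeasurableSpace Z] [BorelSpace Z]

/-- The Hardy–Littlewood maximal operator of a family of subsets of `S`, with respect to `ρ`. -/
def maximalFunction {h : HTypeAlgebra V Z} (ℱ : Set (Set h.S)) (f : h.S → ℂ) (p : h.S) : ℝ≥0∞ :=
  ⨆ F ∈ ℱ, ⨆ (_ : p ∈ F), (S.ρ F)⁻¹ * ∫⁻ q in F, ‖f q‖ₑ ∂S.ρ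

/-- The maximal operator of the family `ℱ` is bounded from `L¹(ρ)` to `L^{1,∞}(ρ)`. -/
def IsWeakTypeOne {h : HTypeAlgebra V Z} (ℱ : Set (Set h.S)) : Prop :=
  ∃ C : ℝ≥0, ∀ f : h.S → ℂ, Integrable f S.ρ →
    Measurable (maximalFunction ℱ f) ∧
    ∀ t : ℝ≥0, t * S.ρ {p | t < maximalFunction ℱ f p} ≤ C * ∫⁻ q, ‖f q‖ₑ ∂S.ρ

end Maximal

/-! ### The families of sets -/

/-- The family `𝓡⁰` of small geodesic balls. -/
def smallBalls (h : HTypeAlgebra V Z) : Set (Set h.S) :=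
  {F | ∃ (p : h.S) (r : ℝ), 0 < r ∧ r < 1 / 2 ∧ F = p.geodesicBall r}

/-- The set `E_{r,b} = B_N(0_N, r^b) × (1/r, r)`. -/
def bigRectangle (h : HTypeAlgebra V Z) (r b : ℝ) : Set h.S :=
  {q | q.n ∈ h.ballN 1 (r ^ b) ∧ q.a ∈ Ioo (1 / r) r}

/-- The family `𝓡^∞` of the left translates of `E_{r,b}`, with `r ≥ e` and `b' < b < b''`. -/
def bigRectangles (h : HTypeAlgebra V Z) (b' b'' : ℝ) : Set (Set h.S) :=
  {F | ∃ (p : h.S) (r b : ℝ), Real.exp 1 ≤ r ∧ b' < b ∧ b < b'' ∧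
    F = (fun q ↦ p * q) '' h.bigRectangle r b}

/-- A collection of (open) dyadic sets on `N`, in the sense of Christ. -/
structure DyadicSystem [MeasurableSpace V] [BorelSpace V] [MeasurableSpace Z] [BorelSpace Z]
    (h : HTypeAlgebra V Z) where
  /-- the index set of the generation `k` -/
  I : ℤ → Type
  countable_I : ∀ k, Countable (I k)
  /-- the dyadic sets -/
  Q : ∀ k, I k → Set h.N
  isOpen_Q : ∀ k α, IsOpen (Q k α)
  /-- the centres -/
  center : ∀ k, I k → h.N
  /-- the ratio `δ` between the sizes of two consecutive generations -/
  δ : ℝ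
  one_lt_δ : 1 < δ
  /-- the inner radius constant -/
  c : ℝ
  c_pos : 0 < c
  /-- the outer radius constant -/
  C : ℝ
  C_pos : 0 < C
  M : ℕ
  null_compl : ∀ k, volume (⋃ α, Q k α)ᶜ = 0
  ball_subset : ∀ k α, h.ballN (center k α) (c * δ ^ k) ⊆ Q k α
  subset_ball : ∀ k α, Q k α ⊆ h.ballN (center k α) (C * δ ^ k)
  disjoint : ∀ k α β, α ≠ β → Q k α ∩ Q k β = ∅
  card_children : ∀ k α, {β : I (k - 1) | Q (k - 1) β ⊆ Q k α}.encard ≤ M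
  existsUnique_parent : ∀ l k, l ≤ k → ∀ β : I l, ∃! α : I k, Q l β ⊆ Q k α
  nested : ∀ l k, l ≤ k → ∀ (α : I k) (β : I l), Q k α ∩ Q l β = ∅ ∨ Q l β ⊆ Q k α

/-- The family `𝓓^∞` of the big admissible sets `Q_α^k × (a₀ / r, a₀ r)`, with `a₀ > 0`, `r ≥ e` and
`a₀^{1/2} r^β ≤ δ^k < a₀^{1/2} r^{4β}`. -/
def DyadicSystem.bigAdmissible [MeasurableSpace V] [BorelSpace V] [MeasurableSpace Z]
    [BorelSpace Z] {h : HTypeAlgebra V Z} (𝒟 : h.DyadicSystem) (β : ℝ) : Set (Set h.S) :=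
  {F | ∃ (k : ℤ) (α : 𝒟.I k) (a₀ r : ℝ), 0 < a₀ ∧ Real.exp 1 ≤ r ∧
    √a₀ * r ^ β ≤ 𝒟.δ ^ k ∧ 𝒟.δ ^ k < √a₀ * r ^ (4 * β) ∧
    F = {q | q.n ∈ 𝒟.Q k α ∧ q.a ∈ Ioo (a₀ / r) (a₀ * r)}}

end HTypeAlgebra

end

open MeasureTheory Set
open scoped ENNReal NNReal Manifold Bundle ContDiff

noncomputable section

/-! All three bounds follow from one Vitali argument. Suppose each set $B$ of a family of open sets
has a size and an enlargement $B'$ with $\rho(B')\le C\rho(B)$, and that every member of no larger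
size meeting $B$ lies in $B'$. Among finitely many members on which $|f|$ has average above $t$,
greedy selection by size leaves disjoint ones whose enlargements cover the rest, and this gives weak
type with constant $C$ (`isWeakTypeOne_of_enlargement`).

For small geodesic balls, $B'$ is the ball of three times the radius. Left translation moves the
centre to the identity, where balls of radius at most $3/2$ are comparable with coordinate balls, so
doubling is inherited from Lebesgue measure.

For the big sets, size is measured in $N$: it is $\delta^k$, or the radius $a^{1/2}r^b$ of the
$N$-part. In the variable $\log a$ the second factor is an interval with centre $\log a_0$ and
radius $\log r$, and $\log(\text{size})$ lies between $\frac12\log a_0+\beta_1\log r$ and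
$\frac12\log a_0+\beta_2\log r$ with $\beta_1>1/2$. When two sets meet, their centres differ by at
most the sum of their radii, which shifts $\frac12\log a_0$ by at most half that sum. As
$\beta_1>1/2$, the set of smaller size has logarithmic radius at most a constant times the other's
(`admissible_radius_le`). A fixed logarithmic enlargement thus suffices, and it costs only a
constant factor of measure. The $N$-part needs nothing in the dyadic case, by nesting, and a
dilation by 9 for rectangles. -/

/-! ### Vitali covering and weak type -/

/-- Greedy selection: from a finite family of sets one can extract a disjoint subfamily such that
each set of the family meets a selected set of at least the same size. -/
theorem Finset.exists_pairwiseDisjoint_forall_exists_inter_nonempty {X ι : Type*} (B : ι → Set X)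
    (s : ι → ℝ) (T : Finset ι) :
    ∃ U ⊆ T, (U : Set ι).PairwiseDisjoint B ∧
      ∀ i ∈ T, (B i).Nonempty → ∃ j ∈ U, (B i ∩ B j).Nonempty ∧ s i ≤ s j := by
  classical
  induction T using Finset.strongInduction with
  | H T ih =>
    rcases T.eq_empty_or_nonempty with rfl | hT
    · exact ⟨∅, le_rfl, by simp, by simp⟩
    obtain ⟨m, hm, hmax⟩ := T.exists_max_image s hT
    -- A largest set is kept and the induction continues on the sets disjoint from it. An empty set
    -- is disjoint from itself, so the filter would not remove it; it is erased separately.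
    by_cases hne : (B m).Nonempty
    · obtain ⟨U, hU, hdisj, hcov⟩ := ih (T.filter fun i ↦ Disjoint (B i) (B m)) <| by
        refine Finset.filter_ssubset.2 ⟨m, hm, ?_⟩
        rwa [disjoint_self, Set.bot_eq_empty, ← Ne, ← Set.nonempty_iff_ne_empty]
      refine ⟨insert m U, ?_, ?_, fun i hi hine ↦ ?_⟩
      · exact Finset.insert_subset hm (hU.trans (Finset.filter_subset _ _))
      · rw [Finset.coe_insert]
        exact hdisj.insert fun j hj _ ↦ (Finset.mem_filter.1 (hU hj)).2.symm
      · by_cases hd : Disjoint (B i) (B m)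
        · obtain ⟨j, hj, h⟩ := hcov i (Finset.mem_filter.2 ⟨hi, hd⟩) hine
          exact ⟨j, Finset.mem_insert_of_mem hj, h⟩
        · exact ⟨m, Finset.mem_insert_self _ _, Set.not_disjoint_iff_nonempty_inter.1 hd, hmax i hi⟩
    · obtain ⟨U, hU, hdisj, hcov⟩ := ih (T.erase m) (Finset.erase_ssubset hm)
      refine ⟨U, hU.trans (Finset.erase_subset _ _), hdisj, fun i hi hine ↦ ?_⟩
      refine hcov i (Finset.mem_erase.2 ⟨?_, hi⟩) hine
      rintro rfl
      exact hne hine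

theorem ENNReal.mul_le_of_lt_inv_mul {a b t : ℝ≥0∞} (h : t < a⁻¹ * b) : t * a ≤ b := by
  rw [mul_comm a⁻¹, ← div_eq_mul_inv] at h
  exact ENNReal.mul_le_of_le_div h.le

/-- The Vitali covering argument for a family of open sets with a size function and
enlargements of comparable measure. -/
theorem mul_measure_biUnion_le_of_enlargement {X ι : Type*} [TopologicalSpace X]
    [SecondCountableTopology X] [MeasurableSpace X] [OpensMeasurableSpace X] {μ : Measure X}
    {B B' : ι → Set X} {s : ι → ℝ} {C : ℝ≥0} (hopen : ∀ i, IsOpen (B i))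
    (hsub : ∀ i j, s i ≤ s j → (B i ∩ B j).Nonempty → B i ⊆ B' j)
    (hvol : ∀ i, μ (B' i) ≤ C * μ (B i)) (f : X → ℝ≥0∞) (t : ℝ≥0) (J : Set ι)
    (hJ : ∀ i ∈ J, t * μ (B i) ≤ ∫⁻ x in B i, f x ∂μ) :
    t * μ (⋃ i ∈ J, B i) ≤ C * ∫⁻ x, f x ∂μ := by
  classical
  have key : ∀ T : Finset ι, (T : Set ι) ⊆ J → t * μ (⋃ i ∈ T, B i) ≤ C * ∫⁻ x, f x ∂μ := by
    intro T hT
    obtain ⟨U, hU, hdisj, hcov⟩ :=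
      T.exists_pairwiseDisjoint_forall_exists_inter_nonempty B s
    calc t * μ (⋃ i ∈ T, B i) ≤ t * μ (⋃ j ∈ U, B' j) := by
          gcongr t * μ ?_
          intro x hx
          obtain ⟨i, hi, hx⟩ := mem_iUnion₂.1 hx
          obtain ⟨j, hj, hij, hs⟩ := hcov i hi ⟨x, hx⟩
          exact mem_iUnion₂.2 ⟨j, hj, hsub i j hs hij hx⟩
      _ ≤ t * ∑ j ∈ U, C * μ (B j) := by
          gcongr
          exact (measure_biUnion_finset_le _ _).trans (Finset.sum_le_sum fun j _ ↦ hvol j)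
      _ = C * ∑ j ∈ U, t * μ (B j) := by
          rw [Finset.mul_sum, Finset.mul_sum]
          exact Finset.sum_congr rfl fun j _ ↦ mul_left_comm _ _ _
      _ ≤ C * ∑ j ∈ U, ∫⁻ x in B j, f x ∂μ := by
          gcongr with j hj
          exact hJ j (hT (hU hj))
      _ = C * ∫⁻ x in ⋃ j ∈ U, B j, f x ∂μ := by
          rw [lintegral_biUnion_finset hdisj fun j _ ↦ (hopen j).measurableSet]
      _ ≤ C * ∫⁻ x, f x ∂μ := by
          gcongr
          exact Measure.restrict_le_self
  -- Lindelöf reduces the union to a countable one, which is the directed union of its finite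
  -- subunions; continuity of the measure then passes `key` to the limit.
  obtain ⟨K, hKJ, hK, hKU⟩ :=
    TopologicalSpace.isOpen_biUnion_countable J B fun i _ ↦ hopen i
  have := hK.to_subtype
  have hdir : Directed (· ⊆ ·) fun T : Finset K ↦ ⋃ i ∈ T, B i :=
    directed_of_isDirected_le fun T T' h ↦ biUnion_mono h fun _ _ ↦ le_rfl
  rw [← hKU, biUnion_eq_iUnion, iUnion_eq_iUnion_finset, hdir.measure_iUnion, ENNReal.mul_iSup]
  refine iSup_le fun T ↦ ?_
  have hT := key (T.image Subtype.val) fun i hi ↦ by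
    obtain ⟨j, -, rfl⟩ := Finset.mem_image.1 hi
    exact hKJ j.2
  rwa [Finset.set_biUnion_finset_image] at hT

namespace HTypeAlgebra

variable {V Z : Type*} [NormedAddCommGroup V] [InnerProductSpace ℝ V] [FiniteDimensional ℝ V]
  [NormedAddCommGroup Z] [InnerProductSpace ℝ Z] [FiniteDimensional ℝ Z]
  [MeasurableSpace V] [BorelSpace V] [MeasurableSpace Z] [BorelSpace Z] {h : HTypeAlgebra V Z}

instance : SecondCountableTopology h.S :=
  inferInstanceAs (SecondCountableTopology h.coordDomain)

/-- A family of open sets to which the Vitali covering argument applies has a maximal operator of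
weak type `(1, 1)`. -/
theorem isWeakTypeOne_of_enlargement {ι : Type*} {ℱ : Set (Set h.S)} {B B' : ι → Set h.S}
    (hℱ : ℱ = range B) {s : ι → ℝ} {C : ℝ≥0} (hopen : ∀ i, IsOpen (B i))
    (hsub : ∀ i j, s i ≤ s j → (B i ∩ B j).Nonempty → B i ⊆ B' j)
    (hvol : ∀ i, S.ρ (B' i) ≤ C * S.ρ (B i)) : IsWeakTypeOne ℱ := by
  refine ⟨C, fun f _ ↦ ?_⟩
  -- Superlevel sets are unions of members of the family, hence open: this gives measurability as
  -- well as the form required by the covering lemma.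
  have hlevel (t : ℝ≥0∞) : {p | t < maximalFunction ℱ f p}
      = ⋃ i ∈ {i | t < (S.ρ (B i))⁻¹ * ∫⁻ q in B i, ‖f q‖ₑ ∂S.ρ}, B i := by
    ext p
    simp only [maximalFunction, hℱ, mem_ofPred_eq, iSup_range, lt_iSup_iff, mem_iUnion,
      exists_prop, and_comm]
  refine ⟨measurable_of_Ioi fun t ↦ ?_, fun t ↦ ?_⟩
  · change MeasurableSet {p | t < maximalFunction ℱ f p}
    rw [hlevel]
    exact (isOpen_biUnion fun i _ ↦ hopen i).measurableSet
  · rw [hlevel]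
    exact mul_measure_biUnion_le_of_enlargement hopen hsub hvol _ t _
      fun i hi ↦ ENNReal.mul_le_of_lt_inv_mul hi

end HTypeAlgebra

/-! ### The measure of rectangles and of left translates -/

theorem lintegral_Ioo_ofReal_inv {u v : ℝ} (hu : 0 < u) (huv : u ≤ v) :
    ∫⁻ a in Ioo u v, ENNReal.ofReal a⁻¹ = ENNReal.ofReal (Real.log (v / u)) := by
  have hv : 0 < v := hu.trans_le huv
  have hint : IntervalIntegrable (fun a : ℝ ↦ a⁻¹) volume u v :=
    intervalIntegral.intervalIntegrable_inv (fun x hx ↦ by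
      rw [uIcc_of_le huv] at hx; exact (hu.trans_le hx.1).ne') continuousOn_id
  rw [← integral_inv_of_pos hu hv, intervalIntegral.integral_of_le huv,
    restrict_Ioo_eq_restrict_Ioc,
    ofReal_integral_eq_lintegral_ofReal ((intervalIntegrable_iff_integrableOn_Ioc_of_le huv).1 hint)]
  exact (ae_restrict_mem measurableSet_Ioc).mono fun a ha ↦ (inv_pos.2 (hu.trans ha.1)).le

/-- Coordinates are grouped as $\mathfrak v\times(\mathfrak z\times\mathbb R)$, while subsets of $N$
live in $\mathfrak v\times\mathfrak z$; reassociation preserves measure, after which Tonelli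
applies. -/
theorem setLIntegral_prodAssoc_symm_preimage_prod {α β γ : Type*} [MeasureSpace α] [MeasureSpace β]
    [MeasureSpace γ] [SFinite (volume : Measure α)] [SFinite (volume : Measure β)]
    [SFinite (volume : Measure γ)] {g : γ → ℝ≥0∞} (hg : Measurable g) (A : Set (α × β)) (B : Set γ) :
    ∫⁻ w in MeasurableEquiv.prodAssoc.symm ⁻¹' (A ×ˢ B), g w.2.2 = volume A * ∫⁻ c in B, g c := by
  have hmp : MeasurePreserving (MeasurableEquiv.prodAssoc.symm : α × β × γ ≃ᵐ (α × β) × γ) :=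
    volume_preserving_prodAssoc.symm
  refine (hmp.setLIntegral_comp_preimage_emb MeasurableEquiv.prodAssoc.symm.measurableEmbedding
    (fun w : (α × β) × γ ↦ g w.2) (A ×ˢ B)).trans ?_
  rw [Measure.volume_eq_prod (α × β) γ, ← Measure.prod_restrict,
    lintegral_prod (fun w ↦ g w.2) (hg.comp measurable_snd).aemeasurable]
  simp only [lintegral_const, Measure.restrict_apply_univ]
  rw [mul_comm]

instance isAddHaarMeasure_volume_prod {E F : Type*} [NormedAddCommGroup E] [MeasureSpace E]
    [BorelSpace E] [NormedAddCommGroup F] [MeasureSpace F] [BorelSpace F]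
    [SecondCountableTopology F]
    [SFinite (volume : Measure E)] [SFinite (volume : Measure F)]
    [(volume : Measure E).IsAddHaarMeasure] [(volume : Measure F).IsAddHaarMeasure] :
    (volume : Measure (E × F)).IsAddHaarMeasure :=
  inferInstanceAs (Measure.prod volume volume).IsAddHaarMeasure

namespace HTypeAlgebra

variable {V Z : Type*} [NormedAddCommGroup V] [InnerProductSpace ℝ V] [FiniteDimensional ℝ V]
  [NormedAddCommGroup Z] [InnerProductSpace ℝ Z] [FiniteDimensional ℝ Z]

namespace S

variable {h : HTypeAlgebra V Z}

theorem continuous_coords : Continuous (coords : h.S → V × Z × ℝ) := continuous_subtype_val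

theorem coords_injective : Function.Injective (coords : h.S → V × Z × ℝ) :=
  Subtype.val_injective

theorem isOpenEmbedding_coords : Topology.IsOpenEmbedding (coords : h.S → V × Z × ℝ) :=
  h.coordDomain.isOpen.isOpenEmbedding_subtypeVal

theorem continuous_n : Continuous (n : h.S → h.N) :=
  (continuous_fst.comp continuous_coords).prodMk
    (continuous_fst.comp (continuous_snd.comp continuous_coords))

theorem continuous_a : Continuous (a : h.S → ℝ) :=
  continuous_snd.comp (continuous_snd.comp continuous_coords)

theorem continuous_mul_left (p : h.S) : Continuous (fun q : h.S ↦ p * q) := by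
  refine isOpenEmbedding_coords.isInducing.continuous_iff.2 ?_
  rw [show coords ∘ (fun q ↦ p * q) = fun q : h.S ↦ (p.x, p.z, (0 : ℝ)) + p.frame q.coords from
    funext (coords_mul p)]
  exact continuous_const.add (p.frame.continuous.comp continuous_coords)

/-- Left translation by `p`, as a homeomorphism. -/
def homeomorphMulLeft (p : h.S) : h.S ≃ₜ h.S where
  toEquiv := Equiv.mulLeft p
  continuous_toFun := continuous_mul_left p
  continuous_invFun := continuous_mul_left p⁻¹

theorem isOpen_image_mul_left (p : h.S) {A : Set h.S} (hA : IsOpen A) :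
    IsOpen ((fun q ↦ p * q) '' A) :=
  (homeomorphMulLeft p).isOpenMap A hA

theorem mem_image_mul_left {p q : h.S} {A : Set h.S} :
    q ∈ (fun q ↦ p * q) '' A ↔ p⁻¹ * q ∈ A := by
  rw [Set.image_mul_left, mem_preimage]

theorem isOpen_rectangle {A : Set h.N} (hA : IsOpen A) (u v : ℝ) :
    IsOpen {q : h.S | q.n ∈ A ∧ q.a ∈ Ioo u v} :=
  (hA.preimage continuous_n).inter (isOpen_Ioo.preimage continuous_a)

section Measure

variable [MeasurableSpace V] [BorelSpace V] [MeasurableSpace Z] [BorelSpace Z]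

theorem measurableEmbedding_coords : MeasurableEmbedding (coords : h.S → V × Z × ℝ) :=
  MeasurableEmbedding.subtype_coe h.coordDomain.isOpen.measurableSet

theorem ρ_apply {A : Set h.S} (hA : MeasurableSet A) :
    ρ A = ∫⁻ v in coords '' A, ENNReal.ofReal v.2.2⁻¹ := by
  have he := measurableEmbedding_coords (h := h)
  rw [ρ, withDensity_apply _ hA]
  have h1 : (volume : Measure (V × Z × ℝ)).restrict (coords '' A)
      = (((volume : Measure (V × Z × ℝ)).comap coords).restrict A).map coords := by
    conv_rhs => rw [← preimage_image_eq A coords_injective]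
    rw [← he.restrict_map, he.map_comap, Measure.restrict_restrict (he.measurableSet_image.2 hA),
      inter_eq_left.2 (image_subset_range _ _)]
  rw [h1, he.lintegral_map]
  rfl

/-- The factor by which left translation by `p` multiplies `ρ`. -/
def modulus (p : h.S) : ℝ≥0∞ :=
  ENNReal.ofReal |(p.frame : (V × Z × ℝ) →L[ℝ] (V × Z × ℝ)).det| * ENNReal.ofReal p.a⁻¹

/-- Left translation is affine in coordinates, so its Jacobian is constant, and it multiplies $a$ by
a constant. The value of the factor never matters: it cancels between a set and its enlargement. -/
theorem ρ_image_mul_left (p : h.S) {A : Set h.S} (hA : IsOpen A) :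
    ρ ((fun q ↦ p * q) '' A) = p.modulus * ρ A := by
  have himg : coords '' ((fun q ↦ p * q) '' A)
      = (fun v ↦ (p.x, p.z, (0 : ℝ)) + p.frame v) '' (coords '' A) := by
    rw [image_image, image_image]
    exact image_congr fun q _ ↦ coords_mul p q
  rw [ρ_apply (isOpen_image_mul_left p hA).measurableSet, ρ_apply hA.measurableSet, himg,
    lintegral_image_eq_lintegral_abs_det_fderiv_mul volume
      (measurableEmbedding_coords.measurableSet_image.2 hA.measurableSet)
      (fun v _ ↦ ((p.frame.hasFDerivAt (x := v)).const_add _).hasFDerivWithinAt)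
      (((add_right_injective _).comp p.frame.injective).injOn),
    modulus, mul_assoc, ← lintegral_const_mul' _ _ ENNReal.ofReal_ne_top,
    ← lintegral_const_mul' _ _ ENNReal.ofReal_ne_top]
  refine lintegral_congr fun v ↦ ?_
  congr 1
  rw [← ENNReal.ofReal_mul (inv_pos.2 p.a_pos).le, ← mul_inv]
  change ENNReal.ofReal (0 + p.a * v.2.2)⁻¹ = _
  rw [zero_add]

theorem ρ_rectangle {A : Set h.N} (hA : IsOpen A) {u v : ℝ} (hu : 0 < u) (huv : u ≤ v) :
    ρ {q : h.S | q.n ∈ A ∧ q.a ∈ Ioo u v}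
      = volume A * ENNReal.ofReal (Real.log (v / u)) := by
  have himg : coords '' {q : h.S | q.n ∈ A ∧ q.a ∈ Ioo u v}
      = MeasurableEquiv.prodAssoc.symm ⁻¹' ((A : Set (V × Z)) ×ˢ Ioo u v) := by
    ext w
    constructor
    · rintro ⟨q, hq, rfl⟩
      exact hq
    · intro hw
      exact ⟨⟨w, hu.trans hw.2.1⟩, hw, rfl⟩
  rw [ρ_apply (isOpen_rectangle hA u v).measurableSet, himg]
  rw [← lintegral_Ioo_ofReal_inv hu huv]
  exact setLIntegral_prodAssoc_symm_preimage_prod (g := fun a ↦ ENNReal.ofReal a⁻¹)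
    (by fun_prop) _ _

end Measure

end S

end HTypeAlgebra

namespace HTypeAlgebra

variable {V Z : Type*} [NormedAddCommGroup V] [InnerProductSpace ℝ V] [FiniteDimensional ℝ V]
  [NormedAddCommGroup Z] [InnerProductSpace ℝ Z] [FiniteDimensional ℝ Z]

/-! ### The homogeneous norm -/

section HomNorm

variable (h : HTypeAlgebra V Z)

/-- With $z=[x,y]$, one has $|z|^2=\langle J_zx,y\rangle\le|z||x||y|$. This is where the $H$-type
condition enters. -/
theorem norm_bracket_le (x y : V) : ‖h.bracket x y‖ ≤ ‖x‖ * ‖y‖ := by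
  rcases eq_or_ne (h.bracket x y) 0 with h0 | h0
  · rw [h0, norm_zero]
    positivity
  refine le_of_mul_le_mul_left ?_ (norm_pos_iff.2 h0)
  calc ‖h.bracket x y‖ * ‖h.bracket x y‖ = inner ℝ (h.bracket x y) (h.bracket x y) :=
        (real_inner_self_eq_norm_mul_norm _).symm
    _ = inner ℝ (LinearMap.adjoint (h.bracket x) (h.bracket x y)) y :=
        (LinearMap.adjoint_inner_left _ _ _).symm
    _ ≤ ‖LinearMap.adjoint (h.bracket x) (h.bracket x y)‖ * ‖y‖ := real_inner_le_norm _ _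
    _ = ‖h.bracket x y‖ * (‖x‖ * ‖y‖) := by rw [h.norm_J, mul_assoc]

theorem homNorm_lt_iff {n : h.N} {s : ℝ} (hs : 0 < s) :
    h.homNorm n < s ↔ ‖n.1‖ ^ 4 / 16 + ‖n.2‖ ^ 2 < s ^ 4 := by
  have h1 : s = (s ^ 4) ^ (1 / 4 : ℝ) := by
    rw [← Real.rpow_natCast s 4, ← Real.rpow_mul hs.le]
    norm_num
  conv_lhs => rw [h1]
  exact Real.rpow_lt_rpow_iff (by positivity) (by positivity) (by norm_num)

theorem homNorm_inv (n : h.N) : h.homNorm n⁻¹ = h.homNorm n := by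
  change (‖-n.1‖ ^ 4 / 16 + ‖-n.2‖ ^ 2) ^ (1 / 4 : ℝ) = _
  rw [norm_neg, norm_neg]
  rfl

theorem continuous_homNorm : Continuous h.homNorm := by
  have h1 : Continuous fun n : V × Z ↦ (‖n.1‖ ^ 4 / 16 + ‖n.2‖ ^ 2) ^ (1 / 4 : ℝ) :=
    Continuous.rpow_const (by fun_prop) fun _ ↦ Or.inr (by norm_num)
  exact h1

theorem mem_ballN_one {n : h.N} {s : ℝ} : n ∈ h.ballN 1 s ↔ h.homNorm n < s := by
  simp [ballN]

theorem isOpen_ballN_one (s : ℝ) : IsOpen (h.ballN 1 s) := by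
  have : h.ballN 1 s = h.homNorm ⁻¹' Iio s := by ext n; exact h.mem_ballN_one
  rw [this]
  exact isOpen_Iio.preimage h.continuous_homNorm

/-- A quasi-triangle inequality with a crude constant is enough. Bounding the two components
separately gives $\mathcal N(nm)^4\le(16+16)s^4<81s^4$. -/
theorem homNorm_mul_lt {n m : h.N} {s : ℝ} (hn : h.homNorm n < s) (hm : h.homNorm m < s) :
    h.homNorm (n * m) < 3 * s := by
  have hs : 0 < s := lt_of_le_of_lt (by unfold homNorm; positivity) hn
  have key (n : h.N) (hn : h.homNorm n < s) : ‖n.1‖ ≤ 2 * s ∧ ‖n.2‖ ≤ s ^ 2 := by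
    rw [h.homNorm_lt_iff hs] at hn
    constructor
    · refine le_of_pow_le_pow_left₀ four_ne_zero (by positivity) ?_
      nlinarith [sq_nonneg ‖n.2‖]
    · refine le_of_pow_le_pow_left₀ two_ne_zero (by positivity) ?_
      nlinarith [pow_nonneg (norm_nonneg n.1) 4]
  obtain ⟨hn1, hn2⟩ := key n hn
  obtain ⟨hm1, hm2⟩ := key m hm
  rw [h.homNorm_lt_iff (by positivity)]
  have hx : ‖(n * m).1‖ ≤ 4 * s := by
    refine (norm_add_le n.1 m.1).trans (by linarith)
  have hz : ‖(n * m).2‖ ≤ 4 * s ^ 2 := by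
    have h1 : ‖h.bracket n.1 m.1‖ ≤ 2 * s * (2 * s) := (h.norm_bracket_le _ _).trans (by gcongr)
    calc ‖(n * m).2‖ = ‖n.2 + m.2 + (1 / 2 : ℝ) • h.bracket n.1 m.1‖ := rfl
      _ ≤ ‖n.2‖ + ‖m.2‖ + 1 / 2 * ‖h.bracket n.1 m.1‖ := by
        refine (norm_add₃_le).trans_eq ?_
        rw [norm_smul, Real.norm_of_nonneg (by norm_num : (0 : ℝ) ≤ 1 / 2)]
      _ ≤ 4 * s ^ 2 := by linarith
  calc ‖(n * m).1‖ ^ 4 / 16 + ‖(n * m).2‖ ^ 2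
      ≤ (4 * s) ^ 4 / 16 + (4 * s ^ 2) ^ 2 := by gcongr
    _ < (3 * s) ^ 4 := by
      have : 0 < s ^ 4 := by positivity
      linarith

/-- The dilation `(X, Z) ↦ (c X, c² Z)`, as a linear map of `𝔳 × 𝔷`. -/
def dilation (V Z : Type*) [NormedAddCommGroup V] [InnerProductSpace ℝ V]
    [NormedAddCommGroup Z] [InnerProductSpace ℝ Z] (c : ℝ) : V × Z →ₗ[ℝ] V × Z :=
  (c • LinearMap.id).prodMap (c ^ 2 • LinearMap.id)

theorem homNorm_dilation {c : ℝ} (hc : 0 < c) (n : V × Z) :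
    h.homNorm (dilation V Z c n : V × Z) = c * h.homNorm n := by
  change (‖c • n.1‖ ^ 4 / 16 + ‖c ^ 2 • n.2‖ ^ 2) ^ (1 / 4 : ℝ)
    = c * (‖n.1‖ ^ 4 / 16 + ‖n.2‖ ^ 2) ^ (1 / 4 : ℝ)
  have h1 : c = (c ^ 4) ^ (1 / 4 : ℝ) := by
    rw [← Real.rpow_natCast c 4, ← Real.rpow_mul hc.le]
    norm_num
  conv_rhs => rw [h1]
  rw [← Real.mul_rpow (by positivity) (by positivity), norm_smul, norm_smul, norm_pow,
    Real.norm_of_nonneg hc.le]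
  congr 1
  ring

theorem volume_ballN_one_mul [MeasurableSpace V] [BorelSpace V] [MeasurableSpace Z] [BorelSpace Z]
    {c : ℝ} (hc : 0 < c) (s : ℝ) :
    volume (h.ballN 1 (c * s))
      ≤ ENNReal.ofReal |LinearMap.det (dilation V Z c)| * volume (h.ballN 1 s) := by
  have hsub : (h.ballN 1 (c * s) : Set (V × Z)) ⊆ dilation V Z c '' (h.ballN 1 s : Set (V × Z)) := by
    intro n hn
    have hinv : dilation V Z c (dilation V Z c⁻¹ n) = n := by
      refine Prod.ext (smul_inv_smul₀ hc.ne' _) ?_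
      change c ^ 2 • c⁻¹ ^ 2 • n.2 = n.2
      rw [smul_smul, ← mul_pow, mul_inv_cancel₀ hc.ne', one_pow, one_smul]
    refine ⟨dilation V Z c⁻¹ n, ?_, hinv⟩
    refine h.mem_ballN_one.2 ?_
    refine (h.homNorm_dilation (inv_pos.2 hc) n).trans_lt ?_
    rw [inv_mul_lt_iff₀ hc]
    exact h.mem_ballN_one.1 hn
  exact (measure_mono (μ := (volume : Measure (V × Z))) hsub).trans_eq
    (Measure.addHaar_image_linearMap _ _ _)

end HomNorm

/-! ### Admissible rectangles -/

/-- Here $u,u'$ are the logarithms of the centres, $l,l'$ those of $r,r'$, and $\kappa,\kappa'$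
those of the sizes. Chaining the inequalities gives
$\beta_1l'\le\frac12(u-u')+\beta_2l\le\frac12(l+l')+\beta_2l$, and $\beta_1>1/2$ absorbs the term
$l'/2$. -/
theorem admissible_radius_le {β₁ β₂ u u' l l' κ κ' : ℝ} (hβ : 1 / 2 < β₁) (h1 : u' / 2 + β₁ * l' ≤ κ')
    (h2 : κ ≤ u / 2 + β₂ * l) (hκ : κ' ≤ κ) (hu : u - u' ≤ l + l') :
    l' ≤ (β₂ + 1 / 2) / (β₁ - 1 / 2) * l := by
  rw [div_mul_eq_mul_div, le_div_iff₀ (by linarith)]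
  linarith

/-- The factor by which logarithmic intervals are enlarged in the covering argument. -/
def enlargementFactor (β₁ β₂ : ℝ) : ℝ := 1 + 2 * ((β₂ + 1 / 2) / (β₁ - 1 / 2))

theorem mem_Ioo_div_mul_iff {a₀ r a : ℝ} (ha₀ : 0 < a₀) (hr : 0 < r) (ha : 0 < a) :
    a ∈ Ioo (a₀ / r) (a₀ * r) ↔ |Real.log a - Real.log a₀| < Real.log r := by
  rw [mem_Ioo, ← Real.log_lt_log_iff (by positivity) ha, ← Real.log_lt_log_iff ha (by positivity),
    Real.log_div ha₀.ne' hr.ne', Real.log_mul ha₀.ne' hr.ne', abs_lt]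
  constructor <;> rintro ⟨h1, h2⟩ <;> constructor <;> linarith

/-- Passing through the common point $q$, the distance from $\log w$ to $\log a_0$ is below $\log
r+2\log r'$; the bound on $\log r'$ turns this into `enlargementFactor` times $\log r$. -/
theorem mem_Ioo_of_admissible {β₁ β₂ a₀ a₀' r r' κ κ' q w : ℝ} (hβ : 1 / 2 < β₁)
    (ha₀ : 0 < a₀) (ha₀' : 0 < a₀') (hr : 0 < r) (hr' : 0 < r')
    (h1 : Real.log a₀' / 2 + β₁ * Real.log r' ≤ κ')
    (h2 : κ ≤ Real.log a₀ / 2 + β₂ * Real.log r) (hκ : κ' ≤ κ)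
    (hq0 : 0 < q) (hw0 : 0 < w)
    (hq : q ∈ Ioo (a₀ / r) (a₀ * r)) (hq' : q ∈ Ioo (a₀' / r') (a₀' * r'))
    (hw : w ∈ Ioo (a₀' / r') (a₀' * r')) :
    w ∈ Ioo (a₀ / r ^ enlargementFactor β₁ β₂) (a₀ * r ^ enlargementFactor β₁ β₂) := by
  rw [mem_Ioo_div_mul_iff (by assumption) (by assumption) (by assumption), abs_lt] at hq hq' hw
  rw [mem_Ioo_div_mul_iff ha₀ (by positivity) hw0, abs_lt, Real.log_rpow hr, enlargementFactor]
  have := admissible_radius_le hβ h1 h2 hκ (by linarith)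
  constructor <;> nlinarith

theorem log_mul_rpow_div_div_rpow {a₀ r : ℝ} (ha₀ : 0 < a₀) (hr : 0 < r) (D : ℝ) :
    Real.log (a₀ * r ^ D / (a₀ / r ^ D)) = D * Real.log (r * r) := by
  have := Real.rpow_pos_of_pos hr D
  rw [show a₀ * r ^ D / (a₀ / r ^ D) = r ^ D * r ^ D by field_simp,
    Real.log_mul this.ne' this.ne', Real.log_mul hr.ne' hr.ne', Real.log_rpow hr]
  ring

theorem one_le_enlargementFactor {β₁ β₂ : ℝ} (hβ : 1 / 2 < β₁) (hβ' : β₁ ≤ β₂) :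
    1 ≤ enlargementFactor β₁ β₂ := by
  have : 0 ≤ (β₂ + 1 / 2) / (β₁ - 1 / 2) := div_nonneg (by linarith) (by linarith)
  unfold enlargementFactor
  linarith

section Measure

variable [MeasurableSpace V] [BorelSpace V] [MeasurableSpace Z] [BorelSpace Z]
  {h : HTypeAlgebra V Z}

/-- For the measure $da/a$, replacing $r$ by $r^D$ multiplies the length of the interval by exactly
$D$. -/
theorem ρ_rectangle_rpow {A : Set h.N} (hA : IsOpen A) {a₀ r D : ℝ} (ha₀ : 0 < a₀)
    (hr : Real.exp 1 ≤ r) (hD : 0 ≤ D) :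
    S.ρ {q : h.S | q.n ∈ A ∧ q.a ∈ Ioo (a₀ / r ^ D) (a₀ * r ^ D)}
      = ENNReal.ofReal D * (volume A * ENNReal.ofReal (Real.log (r * r))) := by
  have hr1 : 1 ≤ r := (Real.one_le_exp zero_le_one).trans hr
  have hr0 : 0 < r := by linarith
  have hrD : 1 ≤ r ^ D := Real.one_le_rpow hr1 hD
  rw [S.ρ_rectangle hA (by positivity)
    ((div_le_self ha₀.le hrD).trans (le_mul_of_one_le_right ha₀.le hrD)),
    log_mul_rpow_div_div_rpow ha₀ hr0, ENNReal.ofReal_mul hD, mul_left_comm]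

/-- The size is the generation $k$. A dyadic set meeting one of a later generation is contained in
it, so only the interval in $a$ is enlarged; admissibility gives $\beta_1=\beta$ and
$\beta_2=4\beta$. -/
theorem DyadicSystem.isWeakTypeOne_bigAdmissible (𝒟 : h.DyadicSystem) {β : ℝ} (hβ : 1 / 2 < β) :
    IsWeakTypeOne (𝒟.bigAdmissible β) := by
  let ι := {i : (Σ k, 𝒟.I k) × ℝ × ℝ // 0 < i.2.1 ∧ Real.exp 1 ≤ i.2.2 ∧
    √i.2.1 * i.2.2 ^ β ≤ 𝒟.δ ^ i.1.1 ∧ 𝒟.δ ^ i.1.1 < √i.2.1 * i.2.2 ^ (4 * β)}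
  let D := enlargementFactor β (4 * β)
  have hD : 1 ≤ D := one_le_enlargementFactor hβ (by linarith)
  -- $E=1$ gives the admissible set itself, $E=D$ its enlargement.
  let R (E : ℝ) (i : ι) : Set h.S := {q | q.n ∈ 𝒟.Q i.1.1.1 i.1.1.2 ∧
    q.a ∈ Ioo (i.1.2.1 / i.1.2.2 ^ E) (i.1.2.1 * i.1.2.2 ^ E)}
  have hrpos (i : ι) : 0 < i.1.2.2 := (Real.exp_pos 1).trans_le i.2.2.1
  have hlogsize (i : ι) (γ : ℝ) : Real.log (√i.1.2.1 * i.1.2.2 ^ γ)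
      = Real.log i.1.2.1 / 2 + γ * Real.log i.1.2.2 := by
    rw [Real.log_mul (Real.sqrt_pos.2 i.2.1).ne' (Real.rpow_pos_of_pos (hrpos i) _).ne',
      Real.log_sqrt i.2.1.le, Real.log_rpow (hrpos i)]
  have hδ : 0 < 𝒟.δ := one_pos.trans 𝒟.one_lt_δ
  refine isWeakTypeOne_of_enlargement (B := R 1) (B' := R D) (s := fun i ↦ (i.1.1.1 : ℝ))
    (C := D.toNNReal) ?_ (fun i ↦ S.isOpen_rectangle (𝒟.isOpen_Q _ _) _ _) ?_ fun i ↦ ?_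
  · ext F
    constructor
    · rintro ⟨k, α, a₀, r, h1, h2, h3, h4, rfl⟩
      exact ⟨⟨⟨⟨k, α⟩, a₀, r⟩, h1, h2, h3, h4⟩, by simp only [R, Real.rpow_one]⟩
    · rintro ⟨⟨⟨⟨k, α⟩, a₀, r⟩, h1, h2, h3, h4⟩, rfl⟩
      exact ⟨k, α, a₀, r, h1, h2, h3, h4, by simp only [R, Real.rpow_one]⟩
  · rintro i j hij ⟨q, ⟨hqn, hqa⟩, hqn', hqa'⟩ w ⟨hwn, hwa⟩
    have hk : i.1.1.1 ≤ j.1.1.1 := by exact_mod_cast hij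
    simp only [Real.rpow_one] at hqa hqa' hwa
    refine ⟨?_, mem_Ioo_of_admissible (κ := Real.log (𝒟.δ ^ j.1.1.1))
      (κ' := Real.log (𝒟.δ ^ i.1.1.1)) hβ j.2.1 i.2.1 (hrpos j) (hrpos i) ?_ ?_ ?_ q.a_pos w.a_pos
      hqa' hqa hwa⟩
    · refine (𝒟.nested _ _ hk j.1.1.2 i.1.1.2).resolve_left ?_ hwn
      exact Set.Nonempty.ne_empty ⟨q.n, hqn', hqn⟩
    · rw [← hlogsize]
      exact Real.log_le_log (mul_pos (Real.sqrt_pos.2 i.2.1) (Real.rpow_pos_of_pos (hrpos i) _))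
        i.2.2.2.1
    · rw [← hlogsize]
      exact Real.log_le_log (by positivity) j.2.2.2.2.le
    · exact Real.log_le_log (by positivity) (zpow_le_zpow_right₀ 𝒟.one_lt_δ.le hk)
  · rw [ρ_rectangle_rpow (𝒟.isOpen_Q _ _) i.2.1 i.2.2.1 zero_le_one,
      ρ_rectangle_rpow (𝒟.isOpen_Q _ _) i.2.1 i.2.2.1 (by linarith), ENNReal.ofReal_one, one_mul]
    rfl

/-! ### The big rectangles -/

omit [MeasurableSpace V] [BorelSpace V] [MeasurableSpace Z] [BorelSpace Z] in
-- The factor $a$ acts on $N$ by the dilation of ratio $a^{1/2}$. Hence the translate of a rectangle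
-- by $p$ is again a rectangle, centred at $p$, with the radius of its $N$-part multiplied by
-- $a^{1/2}$.
theorem S.n_inv_mul (p q : h.S) :
    (p⁻¹ * q).n = dilation V Z (√p.a)⁻¹ (p.n⁻¹ * q.n : h.N) := by
  have ha : (√p.a)⁻¹ ^ 2 = p.a⁻¹ := by rw [inv_pow, Real.sq_sqrt p.a_pos.le]
  refine Prod.ext ?_ ?_
  · change -((√p.a)⁻¹ • p.x) + √(p.a⁻¹) • q.x = (√p.a)⁻¹ • (-p.x + q.x)
    rw [Real.sqrt_inv, smul_add, smul_neg]
  · change -(p.a⁻¹ • p.z) + p.a⁻¹ • q.z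
        + (1 / 2 * √(p.a⁻¹)) • h.bracket (-((√p.a)⁻¹ • p.x)) q.x
      = (√p.a)⁻¹ ^ 2 • (-p.z + q.z + (1 / 2 : ℝ) • h.bracket (-p.x) q.x)
    rw [Real.sqrt_inv, ← smul_neg (√p.a)⁻¹ p.x, map_smul, LinearMap.smul_apply, smul_smul, mul_assoc,
      ← sq, ha, smul_add, smul_add, smul_neg, smul_smul, mul_comm (1 / 2 : ℝ)]

omit [MeasurableSpace V] [BorelSpace V] [MeasurableSpace Z] [BorelSpace Z] in
theorem S.mem_image_mul_left_rectangle {p q : h.S} {s R : ℝ} :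
    q ∈ (fun q ↦ p * q) '' {q : h.S | q.n ∈ h.ballN 1 s ∧ q.a ∈ Ioo (1 / R) (1 * R)} ↔
      h.homNorm (p.n⁻¹ * q.n) < √p.a * s ∧ q.a ∈ Ioo (p.a / R) (p.a * R) := by
  have hp := p.a_pos
  rw [S.mem_image_mul_left]
  refine and_congr ?_ ?_
  · rw [h.mem_ballN_one, S.n_inv_mul, ← inv_mul_lt_iff₀ (Real.sqrt_pos.2 hp)]
    exact iff_of_eq (congrArg (· < s) (h.homNorm_dilation (inv_pos.2 (Real.sqrt_pos.2 hp)) _))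
  · change 1 / R < p.a⁻¹ * q.a ∧ p.a⁻¹ * q.a < 1 * R ↔ _
    rw [inv_mul_lt_iff₀ hp, lt_inv_mul_iff₀ hp, mul_one_div, one_mul, mem_Ioo]

omit [MeasurableSpace V] [BorelSpace V] [MeasurableSpace Z] [BorelSpace Z] in
-- Write $n^{-1}w=(n^{-1}m)(m^{-1}n')(n'^{-1}w)$; each of the two products costs a factor 3.
theorem homNorm_inv_mul_lt {n n' m w : h.N} {s s' : ℝ} (hs : s' ≤ s)
    (hm : h.homNorm (n⁻¹ * m) < s) (hm' : h.homNorm (n'⁻¹ * m) < s')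
    (hw : h.homNorm (n'⁻¹ * w) < s') : h.homNorm (n⁻¹ * w) < 9 * s := by
  have h0 : 0 ≤ h.homNorm (n⁻¹ * m) := by unfold homNorm; positivity
  have h1 : h.homNorm (m⁻¹ * n') < s := by
    rw [← h.homNorm_inv, mul_inv_rev, inv_inv]
    exact hm'.trans_le hs
  have h2 := h.homNorm_mul_lt (h.homNorm_mul_lt hm h1)
    (hw.trans_le (hs.trans (by linarith : s ≤ 3 * s)))
  rw [show n⁻¹ * w = n⁻¹ * m * (m⁻¹ * n') * (n'⁻¹ * w) by group]
  linarith

/-- The size is the radius $a^{1/2}r^b$ of the $N$-part of the translate. As $b'<b<b''$ and $\log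
r>0$, the radius comparison applies with $\beta_1=b'$ and $\beta_2=b''$. -/
theorem isWeakTypeOne_bigRectangles {b' b'' : ℝ} (hb' : 1 / 2 < b') (hb : b' < b'') :
    IsWeakTypeOne (h.bigRectangles b' b'') := by
  let ι := {i : h.S × ℝ × ℝ // Real.exp 1 ≤ i.2.1 ∧ b' < i.2.2 ∧ i.2.2 < b''}
  let D := enlargementFactor b' b''
  have hD : 1 ≤ D := one_le_enlargementFactor hb' hb.le
  -- $K$ dilates the $N$-ball and $E$ the logarithmic interval: $(1,1)$ is the original set, $(9,D)$
  -- its enlargement.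
  let R (K E : ℝ) (i : ι) : Set h.S := (fun q ↦ i.1.1 * q) '' {q : h.S |
    q.n ∈ h.ballN 1 (K * i.1.2.1 ^ i.1.2.2) ∧ q.a ∈ Ioo (1 / i.1.2.1 ^ E) (1 * i.1.2.1 ^ E)}
  have hrpos (i : ι) : 0 < i.1.2.1 := (Real.exp_pos 1).trans_le i.2.1
  have hlogr (i : ι) : 0 < Real.log i.1.2.1 :=
    Real.log_pos ((Real.one_lt_exp_iff.2 one_pos).trans_le i.2.1)
  have hsize (i : ι) : 0 < √i.1.1.a * i.1.2.1 ^ i.1.2.2 :=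
    mul_pos (Real.sqrt_pos.2 i.1.1.a_pos) (Real.rpow_pos_of_pos (hrpos i) _)
  have hlogsize (i : ι) : Real.log (√i.1.1.a * i.1.2.1 ^ i.1.2.2)
      = Real.log i.1.1.a / 2 + i.1.2.2 * Real.log i.1.2.1 := by
    rw [Real.log_mul (Real.sqrt_pos.2 i.1.1.a_pos).ne' (Real.rpow_pos_of_pos (hrpos i) _).ne',
      Real.log_sqrt i.1.1.a_pos.le, Real.log_rpow (hrpos i)]
  have hR1 (i : ι) : R 1 1 i = (fun q ↦ i.1.1 * q) '' h.bigRectangle i.1.2.1 i.1.2.2 := by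
    simp only [R, bigRectangle, Real.rpow_one, one_mul]
  have hRopen (K E : ℝ) (i : ι) := S.isOpen_rectangle (h.isOpen_ballN_one (K * i.1.2.1 ^ i.1.2.2))
    (1 / i.1.2.1 ^ E) (1 * i.1.2.1 ^ E)
  refine isWeakTypeOne_of_enlargement (B := R 1 1) (B' := R 9 D)
    (s := fun i ↦ √i.1.1.a * i.1.2.1 ^ i.1.2.2)
    (C := |LinearMap.det (dilation V Z 9)|.toNNReal * D.toNNReal) ?_
    (fun i ↦ S.isOpen_image_mul_left _ (hRopen 1 1 i)) ?_ fun i ↦ ?_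
  · ext F
    constructor
    · rintro ⟨p, r, b, h1, h2, h3, rfl⟩
      exact ⟨⟨⟨p, r, b⟩, h1, h2, h3⟩, hR1 _⟩
    · rintro ⟨i, rfl⟩
      exact ⟨i.1.1, i.1.2.1, i.1.2.2, i.2.1, i.2.2.1, i.2.2.2, hR1 i⟩
  · rintro i j hij ⟨q, hqi, hqj⟩ w hwi
    obtain ⟨hqn, hqa⟩ := S.mem_image_mul_left_rectangle.1 hqi
    obtain ⟨hqn', hqa'⟩ := S.mem_image_mul_left_rectangle.1 hqj
    obtain ⟨hwn, hwa⟩ := S.mem_image_mul_left_rectangle.1 hwi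
    simp only [Real.rpow_one, one_mul] at hqn hqn' hwn hqa hqa' hwa
    refine S.mem_image_mul_left_rectangle.2 ⟨?_, ?_⟩
    · rw [mul_left_comm]
      exact homNorm_inv_mul_lt hij hqn' hqn hwn
    · refine mem_Ioo_of_admissible (κ := Real.log (√j.1.1.a * j.1.2.1 ^ j.1.2.2))
        (κ' := Real.log (√i.1.1.a * i.1.2.1 ^ i.1.2.2)) hb' j.1.1.a_pos i.1.1.a_pos (hrpos j)
        (hrpos i) ?_ ?_ (Real.log_le_log (hsize i) hij) q.a_pos w.a_pos hqa' hqa hwa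
      · rw [hlogsize]
        gcongr
        · exact (hlogr i).le
        · exact i.2.2.1.le
      · rw [hlogsize]
        gcongr
        · exact (hlogr j).le
        · exact j.2.2.2.le
  · simp only [R]
    rw [S.ρ_image_mul_left _ (hRopen 9 D i), S.ρ_image_mul_left _ (hRopen 1 1 i),
      ρ_rectangle_rpow (h.isOpen_ballN_one _) one_pos i.2.1 (by linarith),
      ρ_rectangle_rpow (h.isOpen_ballN_one _) one_pos i.2.1 zero_le_one, ENNReal.ofReal_one,
      one_mul, one_mul]
    refine (mul_le_mul_right (mul_le_mul_right (mul_le_mul_left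
      (h.volume_ballN_one_mul (by norm_num : (0 : ℝ) < 9) _) _) _) _).trans_eq ?_
    rw [ENNReal.coe_mul]
    change _ = ENNReal.ofReal _ * ENNReal.ofReal _ * _
    ring

end Measure

end HTypeAlgebra

/-! ### The left-invariant distance in coordinates -/

namespace HTypeAlgebra

variable {V Z : Type*} [NormedAddCommGroup V] [InnerProductSpace ℝ V] [FiniteDimensional ℝ V]
  [NormedAddCommGroup Z] [InnerProductSpace ℝ Z] [FiniteDimensional ℝ Z]

namespace S

variable {h : HTypeAlgebra V Z}

/-- The Riemannian norm at `p` of a vector `v`, given in coordinates. -/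
def speed (p : h.S) (v : V × Z × ℝ) : ℝ := √(p.metricForm v v)

theorem norm_tangentSpace (p : h.S) (v : TangentSpace 𝓘(ℝ, V × Z × ℝ) p) :
    ‖v‖ = p.speed v := rfl

theorem enorm_tangentSpace (p : h.S) (v : TangentSpace 𝓘(ℝ, V × Z × ℝ) p) :
    ‖v‖ₑ = ENNReal.ofReal (p.speed v) := by
  rw [← ofReal_norm, norm_tangentSpace]

/-- One chart covers $S$, so smoothness and velocity of curves can be read in the coordinates. -/
theorem mem_source_extChartAt (p q : h.S) : q ∈ (extChartAt 𝓘(ℝ, V × Z × ℝ) p).source := by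
  rw [extChartAt_source]
  change q ∈ ((chartAt (V × Z × ℝ) p.1).subtypeRestr (s := h.coordDomain) ⟨p⟩).source
  rw [OpenPartialHomeomorph.subtypeRestr_source]
  exact mem_univ _

theorem contMDiffOn_iff_coords {γ : ℝ → h.S} {s : Set ℝ} :
    ContMDiffOn 𝓘(ℝ) 𝓘(ℝ, V × Z × ℝ) 1 γ s ↔ ContDiffOn ℝ 1 (coords ∘ γ) s := by
  constructor
  · intro hγ
    rw [← contMDiffOn_iff_contDiffOn]
    have h1 : ContMDiff 𝓘(ℝ, V × Z × ℝ) 𝓘(ℝ, V × Z × ℝ) 1 (coords : h.S → V × Z × ℝ) :=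
      contMDiff_subtype_val (U := h.coordDomain)
    exact h1.comp_contMDiffOn hγ
  · intro hγ
    rw [← contMDiffOn_iff_contDiffOn] at hγ
    have hmem (t : ℝ) : (coords ∘ γ) t ∈ (extChartAt 𝓘(ℝ, V × Z × ℝ) (1 : h.S)).target :=
      (extChartAt 𝓘(ℝ, V × Z × ℝ) (1 : h.S)).map_source (mem_source_extChartAt 1 (γ t))
    refine ((contMDiffOn_extChartAt_symm (I := 𝓘(ℝ, V × Z × ℝ)) (n := 1) (1 : h.S)).comp hγ
      fun t _ ↦ hmem t).congr fun t _ ↦ ?_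
    exact ((extChartAt 𝓘(ℝ, V × Z × ℝ) (1 : h.S)).left_inv (mem_source_extChartAt 1 (γ t))).symm

theorem mfderivWithin_eq_derivWithin_coords {γ : ℝ → h.S} {s : Set ℝ} {t : ℝ}
    (hγ : MDifferentiableWithinAt 𝓘(ℝ) 𝓘(ℝ, V × Z × ℝ) γ s t) :
    (mfderivWithin 𝓘(ℝ) 𝓘(ℝ, V × Z × ℝ) γ s t (1 : ℝ) : V × Z × ℝ)
      = derivWithin (coords ∘ γ) s t := by
  rw [hγ.mfderivWithin]
  simp only [writtenInExtChartAt, extChartAt_model_space_eq_id, PartialEquiv.refl_symm,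
    PartialEquiv.refl_coe, Function.comp_id, modelWithCornersSelf_coe, range_id, preimage_id, id,
    inter_univ]
  rfl

theorem pathELength_eq {γ : ℝ → h.S} (hγ : ContDiffOn ℝ 1 (coords ∘ γ) (Icc 0 1)) :
    Manifold.pathELength 𝓘(ℝ, V × Z × ℝ) γ 0 1
      = ∫⁻ t in Icc (0 : ℝ) 1,
        ENNReal.ofReal ((γ t).speed (derivWithin (coords ∘ γ) (Icc 0 1) t)) := by
  rw [Manifold.pathELength_eq_lintegral_mfderivWithin_Icc]
  refine setLIntegral_congr_fun measurableSet_Icc fun t ht ↦ ?_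
  have h1 := mfderivWithin_eq_derivWithin_coords
    ((contMDiffOn_iff_coords.2 hγ).mdifferentiableOn one_ne_zero t ht)
  rw [enorm_tangentSpace, ← h1]
  rfl

/-- The chain rule for composed left translations; it makes the speed, and hence the length of
curves, left invariant. -/
theorem frame_mul (p q : h.S) (v : V × Z × ℝ) : (p * q).frame v = p.frame (q.frame v) := by
  have hs : √(p.a * q.a) = √p.a * √q.a := Real.sqrt_mul p.a_pos.le _
  have hp : √p.a * √p.a = p.a := Real.mul_self_sqrt p.a_pos.le
  refine Prod.ext ?_ (Prod.ext ?_ (mul_assoc _ _ _))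
  · change √(p.a * q.a) • v.1 = √p.a • √q.a • v.1
    rw [hs, mul_smul]
  · change (p.a * q.a) • v.2.1 + (1 / 2 * √(p.a * q.a)) • h.bracket (p.x + √p.a • q.x) v.1
      = p.a • (q.a • v.2.1 + (1 / 2 * √q.a) • h.bracket q.x v.1)
        + (1 / 2 * √p.a) • h.bracket p.x (√q.a • v.1)
    rw [hs]
    simp only [map_add, map_smul, LinearMap.add_apply, LinearMap.smul_apply, smul_add, smul_smul]
    rw [show 1 / 2 * (√p.a * √q.a) * √p.a = p.a * (1 / 2 * √q.a) by
        linear_combination (1 / 2 * √q.a) * hp,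
      show 1 / 2 * √p.a * √q.a = 1 / 2 * (√p.a * √q.a) by ring]
    abel

theorem speed_mul_frame (p q : h.S) (v : V × Z × ℝ) : (p * q).speed (p.frame v) = q.speed v := by
  have h1 : (p * q).frame.symm (p.frame v) = q.frame.symm v := by
    rw [ContinuousLinearEquiv.symm_apply_eq, frame_mul, ContinuousLinearEquiv.apply_symm_apply]
  rw [speed, speed, metricForm_apply, metricForm_apply, h1]

theorem speed_frame (p : h.S) (v : V × Z × ℝ) :
    p.speed (p.frame v) = √(‖v.1‖ ^ 2 + ‖v.2.1‖ ^ 2 + ‖v.2.2‖ ^ 2) := by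
  rw [speed, metricForm_apply, ContinuousLinearEquiv.symm_apply_apply, innerAtIdentity_self]

theorem norm_le_speed_frame (p : h.S) (v : V × Z × ℝ) : ‖v‖ ≤ p.speed (p.frame v) := by
  rw [speed_frame, Prod.norm_def, Prod.norm_def]
  refine max_le ?_ (max_le ?_ ?_) <;> refine Real.le_sqrt_of_sq_le ?_ <;> nlinarith [sq_nonneg ‖v.1‖,
    sq_nonneg ‖v.2.1‖, sq_nonneg ‖v.2.2‖]

/-- The product carries the maximum norm, and the Euclidean combination of three components is at
most $\sqrt3\le2$ times it. -/
theorem speed_frame_le (p : h.S) (v : V × Z × ℝ) : p.speed (p.frame v) ≤ 2 * ‖v‖ := by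
  have h1 : ‖v.1‖ ≤ ‖v‖ := norm_fst_le v
  have h2 : ‖v.2.1‖ ≤ ‖v‖ := (norm_fst_le v.2).trans (norm_snd_le v)
  have h3 : ‖v.2.2‖ ≤ ‖v‖ := (norm_snd_le v.2).trans (norm_snd_le v)
  rw [speed_frame]
  refine Real.sqrt_le_iff.2 ⟨by positivity, ?_⟩
  nlinarith [pow_le_pow_left₀ (norm_nonneg _) h1 2, pow_le_pow_left₀ (norm_nonneg _) h2 2,
    pow_le_pow_left₀ (norm_nonneg _) h3 2, sq_nonneg ‖v‖]

/-- The Riemannian distance of `S`. -/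
abbrev dist (p q : h.S) : ℝ≥0∞ := Manifold.riemannianEDist 𝓘(ℝ, V × Z × ℝ) p q

theorem dist_le_of_path {γ : ℝ → h.S} (hγ : ContDiffOn ℝ 1 (coords ∘ γ) (Icc 0 1)) :
    dist (γ 0) (γ 1) ≤ ∫⁻ t in Icc (0 : ℝ) 1,
        ENNReal.ofReal ((γ t).speed (derivWithin (coords ∘ γ) (Icc 0 1) t)) :=
  (Manifold.riemannianEDist_le_pathELength (contMDiffOn_iff_coords.2 hγ) rfl rfl
    zero_le_one).trans_eq (pathELength_eq hγ)

theorem exists_path_of_dist_lt {p q : h.S} {r : ℝ≥0∞} (hr : dist p q < r) :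
    ∃ γ : ℝ → h.S, γ 0 = p ∧ γ 1 = q ∧ ContDiffOn ℝ 1 (coords ∘ γ) (Icc 0 1) ∧
      ∫⁻ t in Icc (0 : ℝ) 1,
        ENNReal.ofReal ((γ t).speed (derivWithin (coords ∘ γ) (Icc 0 1) t)) < r := by
  obtain ⟨γ, h0, h1, hγ, hlt⟩ := Manifold.exists_lt_of_riemannianEDist_lt hr
  have hγ' := contMDiffOn_iff_coords.1 hγ
  exact ⟨γ, h0, h1, hγ', by rwa [← pathELength_eq hγ']⟩

theorem dist_mul_left_le (p q q' : h.S) : dist (p * q) (p * q') ≤ dist q q' := by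
  refine le_of_forall_gt fun r hr ↦ ?_
  obtain ⟨γ, rfl, rfl, hγ, hlt⟩ := exists_path_of_dist_lt hr
  have hcoords : coords ∘ (fun t ↦ p * γ t)
      = fun t ↦ (p.x, p.z, (0 : ℝ)) + p.frame ((coords ∘ γ) t) := funext fun t ↦ coords_mul p (γ t)
  refine (dist_le_of_path (γ := fun t ↦ p * γ t) ?_).trans_lt (lt_of_eq_of_lt ?_ hlt)
  · rw [hcoords]
    exact contDiffOn_const.add (p.frame.contDiff.comp_contDiffOn hγ)
  · refine setLIntegral_congr_fun measurableSet_Icc fun t ht ↦ ?_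
    have hd := (hγ.differentiableOn one_ne_zero t ht).hasDerivWithinAt
    have hd' : HasDerivWithinAt (coords ∘ (fun t ↦ p * γ t))
        (p.frame (derivWithin (coords ∘ γ) (Icc 0 1) t)) (Icc 0 1) t := by
      rw [hcoords]
      exact (p.frame.hasFDerivAt.comp_hasDerivWithinAt t hd).const_add _
    rw [hd'.derivWithin (uniqueDiffOn_Icc zero_lt_one t ht), speed_mul_frame]

theorem dist_inv_mul (p q : h.S) : dist 1 (p⁻¹ * q) = dist p q := by
  refine le_antisymm ?_ ?_
  · simpa using dist_mul_left_le p⁻¹ p q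
  · simpa using dist_mul_left_le p 1 (p⁻¹ * q)

end S

end HTypeAlgebra

/-! ### Comparison of geodesic and coordinate balls -/

/-- Applied with $g$ the Riemannian speed of a curve, to $\log a$, $a$, $X$ and $Z$ in turn. -/
theorem norm_sub_le_of_norm_derivWithin_le {E : Type*} [NormedAddCommGroup E] [NormedSpace ℝ E]
    [CompleteSpace E] {f : ℝ → E} (hf : ContDiffOn ℝ 1 f (Icc 0 1)) {g : ℝ → ℝ} {K L : ℝ}
    (hK : 0 ≤ K) (hL : 0 ≤ L)
    (hg : ∀ t ∈ Icc (0 : ℝ) 1, ‖derivWithin f (Icc 0 1) t‖ ≤ K * g t)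
    (hint : ∫⁻ t in Icc (0 : ℝ) 1, ENNReal.ofReal (g t) ≤ ENNReal.ofReal L) {t : ℝ}
    (ht : t ∈ Icc (0 : ℝ) 1) : ‖f t - f 0‖ ≤ K * L := by
  have hsub : Icc 0 t ⊆ Icc (0 : ℝ) 1 := Icc_subset_Icc_right ht.2
  have h1 := enorm_sub_le_lintegral_deriv_of_contDiffOn_Icc (hf.mono hsub) ht.1
  rw [← ENNReal.ofReal_le_ofReal_iff (by positivity), ofReal_norm]
  refine h1.trans ?_
  rw [← restrict_Ioo_eq_restrict_Icc]
  calc ∫⁻ x in Ioo 0 t, ‖deriv f x‖ₑ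
      ≤ ∫⁻ x in Ioo 0 t, ENNReal.ofReal K * ENNReal.ofReal (g x) := by
        refine setLIntegral_mono' measurableSet_Ioo fun x hx ↦ ?_
        have hx' : Icc (0 : ℝ) 1 ∈ nhds x := Icc_mem_nhds hx.1 (hx.2.trans_le ht.2)
        rw [← derivWithin_of_mem_nhds hx', ← ENNReal.ofReal_mul hK, ← ofReal_norm]
        exact ENNReal.ofReal_le_ofReal (hg x (hsub ⟨hx.1.le, hx.2.le⟩))
    _ = ENNReal.ofReal K * ∫⁻ x in Ioo 0 t, ENNReal.ofReal (g x) :=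
        lintegral_const_mul' _ _ ENNReal.ofReal_ne_top
    _ ≤ ENNReal.ofReal K * ∫⁻ x in Icc 0 1, ENNReal.ofReal (g x) :=
        mul_le_mul_right (lintegral_mono_set (Ioo_subset_Icc_self.trans hsub)) _
    _ ≤ ENNReal.ofReal K * ENNReal.ofReal L := mul_le_mul_right hint _
    _ = ENNReal.ofReal (K * L) := (ENNReal.ofReal_mul hK).symm

namespace HTypeAlgebra

variable {V Z : Type*} [NormedAddCommGroup V] [InnerProductSpace ℝ V] [FiniteDimensional ℝ V]
  [NormedAddCommGroup Z] [InnerProductSpace ℝ Z] [FiniteDimensional ℝ Z]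

namespace S

variable {h : HTypeAlgebra V Z}

/-- The coordinate segment from the identity has length at most $4|w|$. Along it $a\ge1/2$ and $X$
is parallel to the velocity, so the bracket term vanishes; the inverse frame costs a factor 2, and
passing from the maximum to the Euclidean norm another 2. -/
theorem dist_one_le {q : h.S} (hq : ‖q.coords - (1 : h.S).coords‖ ≤ 1 / 2) :
    dist 1 q ≤ ENNReal.ofReal (4 * ‖q.coords - (1 : h.S).coords‖) := by
  set w := q.coords - (1 : h.S).coords with hw
  have hw2 : ‖w.2.2‖ ≤ 1 / 2 := ((norm_snd_le w.2).trans (norm_snd_le w)).trans hq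
  have hpos : ∀ t ∈ Icc (0 : ℝ) 1, 1 / 2 ≤ 1 + t * w.2.2 := fun t ht ↦ by
    rw [Real.norm_eq_abs, abs_le] at hw2
    nlinarith [ht.1, ht.2]
  classical
  let γ : ℝ → h.S := fun t ↦
    if ht : 0 < 1 + t * w.2.2 then mk (t • w.1) (t • w.2.1) (1 + t * w.2.2) ht else 1
  have hγ (t : ℝ) (ht : t ∈ Icc (0 : ℝ) 1) : (γ t).coords = (1 : h.S).coords + t • w := by
    have ht' : 0 < 1 + t * w.2.2 := by linarith [hpos t ht]
    simp only [γ, dif_pos ht']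
    exact Prod.ext (zero_add _).symm (Prod.ext (zero_add _).symm rfl)
  have h0 : γ 0 = 1 := coords_injective (by rw [hγ 0 (by simp), zero_smul, add_zero])
  have h1 : γ 1 = q := coords_injective (by rw [hγ 1 (by simp), one_smul, hw, add_sub_cancel])
  have haff (t : ℝ) : HasDerivAt (fun t : ℝ ↦ (1 : h.S).coords + t • w) w t := by
    simpa using ((hasDerivAt_id t).smul_const w).const_add (1 : h.S).coords
  have hC : ContDiffOn ℝ 1 (coords ∘ γ) (Icc 0 1) :=
    ContDiffOn.congr (by fun_prop) hγ
  have hle := dist_le_of_path hC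
  rw [h0, h1] at hle
  refine hle.trans ((setLIntegral_mono' measurableSet_Icc fun t ht ↦
    ENNReal.ofReal_le_ofReal (?_ : _ ≤ 4 * ‖w‖)).trans_eq (by simp))
  rw [derivWithin_congr (f₁ := coords ∘ γ) hγ (hγ t ht),
    (haff t).hasDerivWithinAt.derivWithin (uniqueDiffOn_Icc zero_lt_one t ht)]
  have hat : (γ t).a = 1 + t * w.2.2 := congrArg (fun v ↦ v.2.2) (hγ t ht)
  have hxt : (γ t).x = t • w.1 := (congrArg (fun v ↦ v.1) (hγ t ht)).trans (zero_add _)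
  have ha : 1 / 2 ≤ (γ t).a := hat ▸ hpos t ht
  have hs : 1 / 2 ≤ √(γ t).a := Real.le_sqrt_of_sq_le (by linarith)
  have hsymm : (γ t).frame.symm w
      = ((√(γ t).a)⁻¹ • w.1, (γ t).a⁻¹ • w.2.1, (γ t).a⁻¹ * w.2.2) := by
    refine Prod.ext rfl (Prod.ext ?_ rfl)
    change (γ t).a⁻¹ • (w.2.1 - (1 / 2 : ℝ) • h.bracket (γ t).x w.1) = _
    simp [hxt, h.bracket_self]
  have hnorm : ‖(γ t).frame.symm w‖ ≤ 2 * ‖w‖ := by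
    have hi : (γ t).a⁻¹ ≤ 2 := inv_le_of_inv_le₀ two_pos (by linarith)
    have hsi : (√(γ t).a)⁻¹ ≤ 2 := inv_le_of_inv_le₀ two_pos (by linarith)
    have hi0 := inv_pos.2 (γ t).a_pos
    rw [hsymm, Prod.norm_def, Prod.norm_def]
    refine max_le ?_ (max_le ?_ ?_)
    · rw [norm_smul, Real.norm_of_nonneg (by positivity)]
      gcongr
      exact norm_fst_le w
    · rw [norm_smul, Real.norm_of_nonneg hi0.le]
      gcongr
      exact (norm_fst_le w.2).trans (norm_snd_le w)
    · rw [norm_mul, Real.norm_of_nonneg hi0.le]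
      gcongr
      exact (norm_snd_le w.2).trans (norm_snd_le w)
  have := speed_frame_le (γ t) ((γ t).frame.symm w)
  rw [ContinuousLinearEquiv.apply_symm_apply] at this
  linarith

/-- Along a curve of length at most `L ≤ 3 / 2` starting at the identity, `a` stays above
`e^{-3/2}`, and the displacement in coordinates is controlled by `L`. -/
theorem coords_bound_of_dist_lt {q : h.S} {L : ℝ} (hL0 : 0 ≤ L) (hL : L ≤ 3 / 2)
    (hq : dist 1 q < ENNReal.ofReal L) :
    Real.exp (-(3 / 2)) ≤ q.a ∧ ‖q.coords - (1 : h.S).coords‖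
      ≤ (Real.exp (3 / 2) + Real.exp (3 / 2) ^ 2) * L := by
  obtain ⟨γ, h0, h1, hγ, hlt⟩ := exists_path_of_dist_lt hq
  set c := coords ∘ γ with hc
  set g : ℝ → ℝ := fun t ↦ (γ t).speed (derivWithin c (Icc 0 1) t) with hg
  have hint := hlt.le
  set A := Real.exp (3 / 2) with hA
  have hA1 : 1 ≤ A := Real.one_le_exp (by norm_num)
  let u : ℝ → V × Z × ℝ := fun t ↦ (γ t).frame.symm (derivWithin c (Icc 0 1) t)
  have hfu (t : ℝ) : (γ t).frame (u t) = derivWithin c (Icc 0 1) t :=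
    ContinuousLinearEquiv.apply_symm_apply _ _
  have hu (t : ℝ) : ‖u t‖ ≤ g t := by
    have := norm_le_speed_frame (γ t) (u t)
    rwa [hfu] at this
  have hu1 (t : ℝ) : ‖(u t).1‖ ≤ g t := (norm_fst_le _).trans (hu t)
  have hu2 (t : ℝ) : ‖(u t).2.1‖ ≤ g t := ((norm_fst_le _).trans (norm_snd_le _)).trans (hu t)
  have hu3 (t : ℝ) : ‖(u t).2.2‖ ≤ g t := ((norm_snd_le _).trans (norm_snd_le _)).trans (hu t)
  have hg0 (t : ℝ) : 0 ≤ g t := Real.sqrt_nonneg _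
  have hd (t : ℝ) (ht : t ∈ Icc (0 : ℝ) 1) : HasDerivWithinAt c ((γ t).frame (u t)) (Icc 0 1) t := by
    rw [hfu]
    exact (hγ.differentiableOn one_ne_zero t ht).hasDerivWithinAt
  have huniq (t : ℝ) (ht : t ∈ Icc (0 : ℝ) 1) := uniqueDiffOn_Icc (zero_lt_one' ℝ) t ht
  have hda (t : ℝ) (ht : t ∈ Icc (0 : ℝ) 1) :
      HasDerivWithinAt (fun t ↦ (c t).2.2) ((γ t).a * (u t).2.2) (Icc 0 1) t :=
    (ContinuousLinearMap.snd ℝ Z ℝ ∘L .snd ℝ V (Z × ℝ)).hasFDerivAt.comp_hasDerivWithinAt t (hd t ht)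
  have hdx (t : ℝ) (ht : t ∈ Icc (0 : ℝ) 1) :
      HasDerivWithinAt (fun t ↦ (c t).1) (√(γ t).a • (u t).1) (Icc 0 1) t :=
    (ContinuousLinearMap.fst ℝ V (Z × ℝ)).hasFDerivAt.comp_hasDerivWithinAt t (hd t ht)
  have hdz (t : ℝ) (ht : t ∈ Icc (0 : ℝ) 1) :
      HasDerivWithinAt (fun t ↦ (c t).2.1)
        ((γ t).a • (u t).2.1 + (1 / 2 * √(γ t).a) • h.bracket (γ t).x (u t).1) (Icc 0 1) t :=
    (ContinuousLinearMap.fst ℝ Z ℝ ∘L .snd ℝ V (Z × ℝ)).hasFDerivAt.comp_hasDerivWithinAt t (hd t ht)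
  have hapos (t : ℝ) : 0 < (c t).2.2 := (γ t).a_pos
  have hc0 : c 0 = (0, 0, 1) := congrArg coords h0
  -- The logarithmic derivative of $a$ is the last component of the velocity in the frame, so $\log
  -- a$ moves by at most the length. This bounds $a$ and $\sqrt a$ by $A$, hence the frame's effect
  -- on the other components.
  have hlog (t : ℝ) (ht : t ∈ Icc (0 : ℝ) 1) : |Real.log (γ t).a| ≤ 3 / 2 := by
    have h2 := norm_sub_le_of_norm_derivWithin_le (f := fun t ↦ Real.log (c t).2.2) (g := g) (K := 1)
      (hγ.snd.snd.log fun t _ ↦ (hapos t).ne') zero_le_one hL0 (fun t ht ↦ ?_) hint ht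
    · simp only [hc0, Real.log_one, sub_zero, one_mul] at h2
      exact h2.trans hL
    · rw [((hda t ht).log (hapos t).ne').derivWithin (huniq t ht), one_mul,
        show (c t).2.2 = (γ t).a from rfl, mul_div_cancel_left₀ _ (γ t).a_pos.ne']
      exact hu3 t
  have haA (t : ℝ) (ht : t ∈ Icc (0 : ℝ) 1) : (γ t).a ≤ A := by
    rw [hA, ← Real.log_le_iff_le_exp (γ t).a_pos]
    exact (abs_le.1 (hlog t ht)).2
  have hsA (t : ℝ) (ht : t ∈ Icc (0 : ℝ) 1) : √(γ t).a ≤ A :=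
    Real.sqrt_le_iff.2 ⟨by linarith, (haA t ht).trans (le_self_pow₀ hA1 two_ne_zero)⟩
  have ha (t : ℝ) (ht : t ∈ Icc (0 : ℝ) 1) : ‖(c t).2.2 - (c 0).2.2‖ ≤ A * L := by
    refine norm_sub_le_of_norm_derivWithin_le (f := fun t ↦ (c t).2.2) (g := g)
      hγ.snd.snd (by linarith) hL0 (fun t ht ↦ ?_) hint ht
    rw [(hda t ht).derivWithin (huniq t ht), norm_mul, Real.norm_of_nonneg (γ t).a_pos.le]
    exact mul_le_mul (haA t ht) (hu3 t) (norm_nonneg _) (by linarith)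
  have hx (t : ℝ) (ht : t ∈ Icc (0 : ℝ) 1) : ‖(c t).1 - (c 0).1‖ ≤ A * L := by
    refine norm_sub_le_of_norm_derivWithin_le (f := fun t ↦ (c t).1) (g := g)
      hγ.fst (by linarith) hL0 (fun t ht ↦ ?_) hint ht
    rw [(hdx t ht).derivWithin (huniq t ht), norm_smul, Real.norm_of_nonneg (Real.sqrt_nonneg _)]
    exact mul_le_mul (hsA t ht) (hu1 t) (norm_nonneg _) (by linarith)
  have hz (t : ℝ) (ht : t ∈ Icc (0 : ℝ) 1) : ‖(c t).2.1 - (c 0).2.1‖ ≤ (A + A ^ 2) * L := by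
    refine norm_sub_le_of_norm_derivWithin_le (f := fun t ↦ (c t).2.1) (g := g)
      hγ.snd.fst (by positivity) hL0 (fun t ht ↦ ?_) hint ht
    -- The bound $L\le2$ makes the bracket term at most $\frac12A\cdot2A\,g=A^2g$.
    have hxt : ‖(γ t).x‖ ≤ A * 2 := by
      have := hx t ht
      rw [hc0, sub_zero] at this
      exact this.trans (by gcongr; linarith)
    rw [(hdz t ht).derivWithin (huniq t ht)]
    calc ‖(γ t).a • (u t).2.1 + (1 / 2 * √(γ t).a) • h.bracket (γ t).x (u t).1‖
        ≤ (γ t).a * ‖(u t).2.1‖ + 1 / 2 * √(γ t).a * ‖h.bracket (γ t).x (u t).1‖ := by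
          refine (norm_add_le _ _).trans_eq ?_
          rw [norm_smul, norm_smul, Real.norm_of_nonneg (γ t).a_pos.le,
            Real.norm_of_nonneg (by positivity)]
      _ ≤ A * g t + 1 / 2 * A * ((A * 2) * g t) := by
          have := (γ t).a_pos
          gcongr
          · exact haA t ht
          · exact hu2 t
          · exact hsA t ht
          · exact (h.norm_bracket_le _ _).trans (by gcongr; exact hu1 t)
      _ = (A + A ^ 2) * g t := by ring
  have h1mem : (1 : ℝ) ∈ Icc (0 : ℝ) 1 := by simp
  have hAL : A * L ≤ (A + A ^ 2) * L := by gcongr; nlinarith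
  constructor
  · have := (abs_le.1 (hlog 1 h1mem)).1
    rw [h1] at this
    exact (Real.le_log_iff_exp_le q.a_pos).1 this
  · have hq' : q.coords - (1 : h.S).coords = c 1 - c 0 := by rw [hc]; simp only [Function.comp, h0, h1]
    rw [hq', Prod.norm_def, Prod.norm_def]
    exact max_le ((hx 1 h1mem).trans hAL) (max_le (hz 1 h1mem) ((ha 1 h1mem).trans hAL))

theorem geodesicBall_eq_image (p : h.S) (r : ℝ) :
    p.geodesicBall r = (fun q ↦ p * q) '' (1 : h.S).geodesicBall r := by
  ext q
  rw [mem_image_mul_left]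
  change dist p q < _ ↔ dist 1 (p⁻¹ * q) < _
  rw [dist_inv_mul]

/-- Openness refers to the coordinate topology: around each point, a left-translated coordinate ball
lies in the geodesic ball, by `dist_one_le` and the triangle inequality. -/
theorem isOpen_geodesicBall (p : h.S) (r : ℝ) : IsOpen (p.geodesicBall r) := by
  rw [isOpen_iff_mem_nhds]
  intro q hq
  have hq : dist p q < ENNReal.ofReal r := hq
  obtain ⟨ε, hε0, hε⟩ := ENNReal.lt_iff_exists_add_pos_lt.1 hq
  let δ : ℝ := min (1 / 2) (ε / 8)
  have hδ : 0 < δ := lt_min (by norm_num) (by positivity)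
  have hopen : IsOpen ((fun w ↦ q * w) '' (coords ⁻¹' Metric.ball (1 : h.S).coords δ)) :=
    isOpen_image_mul_left q (Metric.isOpen_ball.preimage continuous_coords)
  refine Filter.mem_of_superset (hopen.mem_nhds ⟨1, Metric.mem_ball_self hδ, mul_one q⟩) ?_
  rintro _ ⟨w, hw, rfl⟩
  rw [mem_preimage, mem_ball_iff_norm] at hw
  have h1 : dist q (q * w) ≤ ε := by
    rw [← dist_inv_mul, inv_mul_cancel_left]
    refine (dist_one_le (hw.le.trans (min_le_left _ _))).trans ?_
    rw [← ENNReal.ofReal_coe_nnreal]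
    refine ENNReal.ofReal_le_ofReal ?_
    have := hw.le.trans (min_le_right _ _)
    have := ε.2
    linarith
  exact (Manifold.riemannianEDist_triangle.trans (add_le_add_right h1 _)).trans_lt hε

section Measure

variable [MeasurableSpace V] [BorelSpace V] [MeasurableSpace Z] [BorelSpace Z]

/-- On the coordinate ball of radius $r/8$, the distance to the identity is below $4r/8<r$ and
$a<2$, so the density $a^{-1}$ exceeds $1/2$. -/
theorem volume_ball_le_ρ_geodesicBall {r : ℝ} (hr : 0 < r) (hr1 : r < 1 / 2) :
    ENNReal.ofReal (1 / 2) * volume (Metric.ball (1 : h.S).coords (r / 8))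
      ≤ ρ ((1 : h.S).geodesicBall r) := by
  rw [ρ_apply (isOpen_geodesicBall _ _).measurableSet]
  have hcoord {w : V × Z × ℝ} (hw : w ∈ Metric.ball (1 : h.S).coords (r / 8)) :
      0 < w.2.2 ∧ w.2.2 < 2 := by
    rw [mem_ball_iff_norm] at hw
    have h2 : |w.2.2 - 1| < r / 8 :=
      ((norm_snd_le (w - (1 : h.S).coords).2).trans (norm_snd_le _)).trans_lt hw
    rw [abs_lt] at h2
    constructor <;> linarith
  have hsub : Metric.ball (1 : h.S).coords (r / 8) ⊆ coords '' (1 : h.S).geodesicBall r := by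
    intro w hw
    refine ⟨⟨w, (hcoord hw).1⟩, ?_, rfl⟩
    rw [mem_ball_iff_norm] at hw
    refine (dist_one_le (q := ⟨w, _⟩) (hw.le.trans (by linarith))).trans_lt ?_
    rw [ENNReal.ofReal_lt_ofReal_iff hr]
    change 4 * ‖w - (1 : h.S).coords‖ < r
    linarith
  rw [← setLIntegral_const]
  refine (setLIntegral_mono' Metric.isOpen_ball.measurableSet fun w hw ↦ ?_).trans
    (lintegral_mono_set hsub)
  refine ENNReal.ofReal_le_ofReal ?_
  rw [one_div, inv_le_inv₀ two_pos (hcoord hw).1]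
  exact (hcoord hw).2.le

theorem ρ_geodesicBall_le {L : ℝ} (hL0 : 0 < L) (hL : L ≤ 3 / 2) :
    ρ ((1 : h.S).geodesicBall L) ≤ ENNReal.ofReal (Real.exp (3 / 2)) * volume (Metric.ball
      (1 : h.S).coords ((Real.exp (3 / 2) + Real.exp (3 / 2) ^ 2 + 1) * L)) := by
  rw [ρ_apply (isOpen_geodesicBall _ _).measurableSet]
  refine (setLIntegral_mono' (g := fun _ ↦ ENNReal.ofReal (Real.exp (3 / 2)))
    (measurableEmbedding_coords.measurableSet_image.2
    (isOpen_geodesicBall _ _).measurableSet) ?_).trans ?_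
  · rintro _ ⟨q, hq, rfl⟩
    refine ENNReal.ofReal_le_ofReal ?_
    have := (coords_bound_of_dist_lt hL0.le hL hq).1
    rw [Real.exp_neg] at this
    exact inv_le_of_inv_le₀ (Real.exp_pos _) this
  · rw [setLIntegral_const]
    refine mul_le_mul_right (measure_mono ?_) _
    rintro _ ⟨q, hq, rfl⟩
    rw [mem_ball_iff_norm]
    refine (coords_bound_of_dist_lt hL0.le hL hq).2.trans_lt ?_
    -- The extra $+1$ in the radius makes the inequality strict, as an open ball requires.
    rw [add_mul _ 1]
    linarith

/-- The small geodesic balls satisfy a doubling condition. -/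
theorem exists_ρ_geodesicBall_three_mul_le : ∃ C : ℝ≥0, ∀ (p : h.S) (r : ℝ), 0 < r → r < 1 / 2 →
    ρ (p.geodesicBall (3 * r)) ≤ C * ρ (p.geodesicBall r) := by
  let A := Real.exp (3 / 2)
  -- The ratio of the outer radius $(A+A^2+1)\cdot3r$ to the inner radius $r/8$. In the doubling
  -- constant below, $A$ and $2$ come from the bounds on the density.
  let k : ℝ := (A + A ^ 2 + 1) * 24
  have hk : 0 < k := by positivity
  let d := Module.finrank ℝ (V × Z × ℝ)
  refine ⟨(A * k ^ d * 2).toNNReal, fun p r hr hr1 ↦ ?_⟩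
  rw [geodesicBall_eq_image, geodesicBall_eq_image p r, ρ_image_mul_left _ (isOpen_geodesicBall _ _),
    ρ_image_mul_left _ (isOpen_geodesicBall _ _), mul_left_comm]
  refine mul_le_mul_right ?_ _
  have h1 := ρ_geodesicBall_le (h := h) (L := 3 * r) (by linarith) (by linarith)
  have hvol : volume (Metric.ball (1 : h.S).coords ((A + A ^ 2 + 1) * (3 * r)))
      = ENNReal.ofReal (k ^ d) * volume (Metric.ball (1 : h.S).coords (r / 8)) := by
    rw [show (A + A ^ 2 + 1) * (3 * r) = k * (r / 8) by simp only [k]; ring,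
      Measure.addHaar_ball_mul_of_pos _ _ hk, ← Measure.addHaar_ball_center _ (1 : h.S).coords]
  calc ρ ((1 : h.S).geodesicBall (3 * r))
      ≤ ENNReal.ofReal A * (ENNReal.ofReal (k ^ d)
        * volume (Metric.ball (1 : h.S).coords (r / 8))) := by rw [← hvol]; exact h1
    _ = ENNReal.ofReal (A * k ^ d * 2) * (ENNReal.ofReal (1 / 2)
        * volume (Metric.ball (1 : h.S).coords (r / 8))) := by
      rw [← mul_assoc, ← mul_assoc, ← ENNReal.ofReal_mul (by positivity),
        ← ENNReal.ofReal_mul (by positivity)]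
      congr 2
      ring
    _ ≤ ENNReal.ofReal (A * k ^ d * 2) * ρ ((1 : h.S).geodesicBall r) :=
      mul_le_mul_right (volume_ball_le_ρ_geodesicBall hr hr1) _

end Measure

end S

theorem isWeakTypeOne_smallBalls [MeasurableSpace V] [BorelSpace V] [MeasurableSpace Z]
    [BorelSpace Z] (h : HTypeAlgebra V Z) : IsWeakTypeOne h.smallBalls := by
  obtain ⟨C, hC⟩ := S.exists_ρ_geodesicBall_three_mul_le (h := h)
  refine isWeakTypeOne_of_enlargement (ι := {i : h.S × ℝ // 0 < i.2 ∧ i.2 < 1 / 2})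
    (B := fun i ↦ i.1.1.geodesicBall i.1.2) (B' := fun i ↦ i.1.1.geodesicBall (3 * i.1.2))
    (s := fun i ↦ i.1.2) (C := C) ?_ (fun i ↦ S.isOpen_geodesicBall _ _) ?_
    fun i ↦ hC _ _ i.2.1 i.2.2
  · ext F
    constructor
    · rintro ⟨p, r, h1, h2, rfl⟩
      exact ⟨⟨⟨p, r⟩, h1, h2⟩, rfl⟩
    · rintro ⟨i, rfl⟩
      exact ⟨i.1.1, i.1.2, i.2.1, i.2.2, rfl⟩
  · rintro ⟨⟨p, r⟩, hr, _⟩ ⟨⟨p', r'⟩, hr', _⟩ hrr ⟨q, hq, hq'⟩ w hw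
    have hrr : r ≤ r' := hrr
    have hq : S.dist p q < ENNReal.ofReal r := hq
    have hq' : S.dist p' q < ENNReal.ofReal r' := hq'
    have hw : S.dist p w < ENNReal.ofReal r := hw
    have hr0 : 0 < r := hr
    have hr0' : 0 < r' := hr'
    change S.dist p' w < ENNReal.ofReal (3 * r')
    calc S.dist p' w ≤ S.dist p' q + S.dist q p + S.dist p w :=
          Manifold.riemannianEDist_triangle.trans
            (add_le_add_left Manifold.riemannianEDist_triangle _)
      _ = S.dist p' q + S.dist p q + S.dist p w := by
          rw [S.dist, S.dist, S.dist, S.dist, Manifold.riemannianEDist_comm (x := q)]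
      _ < ENNReal.ofReal r' + ENNReal.ofReal r + ENNReal.ofReal r :=
          ENNReal.add_lt_add (ENNReal.add_lt_add hq' hq) hw
      _ = ENNReal.ofReal (r' + r + r) := by
          rw [ENNReal.ofReal_add (by positivity) hr0.le, ENNReal.ofReal_add hr0'.le hr0.le]
      _ ≤ ENNReal.ofReal (3 * r') := ENNReal.ofReal_le_ofReal (by linarith)

end HTypeAlgebra

theorem theorem2 {V Z : Type*} [NormedAddCommGroup V] [InnerProductSpace ℝ V]
    [FiniteDimensional ℝ V] [MeasurableSpace V] [BorelSpace V]
    [NormedAddCommGroup Z] [InnerProductSpace ℝ Z]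
    [FiniteDimensional ℝ Z] [MeasurableSpace Z] [BorelSpace Z]
    [Nontrivial (V × Z)] (h : HTypeAlgebra V Z) :
    HTypeAlgebra.IsWeakTypeOne h.smallBalls ∧
    (∀ b' b'' : ℝ, 1 / 2 < b' → b' < b'' →
      HTypeAlgebra.IsWeakTypeOne (h.bigRectangles b' b'')) ∧
    (∀ (𝒟 : h.DyadicSystem) (β : ℝ), 3 / 2 < β →
      HTypeAlgebra.IsWeakTypeOne (𝒟.bigAdmissible β)) :=
  ⟨h.isWeakTypeOne_smallBalls, fun _ _ ↦ HTypeAlgebra.isWeakTypeOne_bigRectangles,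
    fun 𝒟 _ hβ ↦ 𝒟.isWeakTypeOne_bigAdmissible (by linarith)⟩

end
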